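/- Let $n\ge 1$ and let $I,J\subset\mathbb{R}^n$ be Lebesgue measurable sets with $0<|I|<\infty$ and $0<|J|<\infty$. On $\mathcal H=L^2(\mathbb{R}^n,dx)$ let $P_If=\chi_If$ and $Q_Jf=(\chi_J\hat f)\check{\ }$, where $\hat{\ }$ is the Fourier-Plancherel transform and $\check{\ }$ its inverse; write $R(\cdot)$ and $N(\cdot)$ for range and nullspace. An operator $X$ is co-diagonal with respect to a projection $P$ if $PXP=0=(1-P)X(1-P)$. Denote by $X_{I,J}$ a bounded selfadjoint operator on $\mathcal H$ with $\|X_{I,J}\|=\pi/2$ which is co-diagonal with respect to both $P_I$ and $Q_J$ and satisfies $e^{iX_{I,J}}P_Ie^{-iX_{I,J}}=Q_J$. (0) If $$R(P_I)\cap N(Q_J)=\{0\}=N(P_I)\cap R(Q_J),\qquad(*)$$ then there is exactly one such operator $X_{I,J}$; condition $(*)$ holds whenever $I$ and $J$ are bounded. Moreover, every such operator $X_{I,J}$ (whether or not $(*)$ holds) has the following properties. (1) $X_{I,J}$ has closed infinite dimensional range; in particular it is not compact. (2) There is a strictly increasing sequence $(\gamma_k)$ in $(0,\pi/2)$ with $\gamma_k\to\pi/2$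 such that $$\sigma(X_{I,J})=\{0\}\cup\{\gamma_k\}_k\cup\{-\gamma_k\}_k\cup\{\pi/2,-\pi/2\}.$$ Here $0$ is an eigenvalue of infinite multiplicity, and $\gamma_k$ and $-\gamma_k$ are eigenvalues with the same finite multiplicity. If $(*)$ holds, then $\pm\pi/2$ are not eigenvalues. (3) If $I_0\subset\mathbb{R}^n$ is measurable with $|I_0|<\infty$ and $|I\cap I_0|=0$, then the commutator $[X_{I,J},P_{I_0}]=X_{I,J}P_{I_0}-P_{I_0}X_{I,J}$ is compact. -/

import Mathlib

open MeasureTheory Filter Topology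
open scoped ENNReal

/-- The Hilbert space `L²(ℝⁿ, dx)` of complex valued functions. -/
abbrev L2Rn (n : ℕ) : Type := Lp (α := EuclideanSpace ℝ (Fin n)) ℂ 2 volume

theorem memLp_indicator {n : ℕ} {I : Set (EuclideanSpace ℝ (Fin n))}
    (hI : NullMeasurableSet I volume) (f : L2Rn n) :
    MemLp (I.indicator f) 2 (volume : Measure (EuclideanSpace ℝ (Fin n))) :=
  (Lp.memLp f).mono ((Lp.aestronglyMeasurable f).indicator₀ hI)
    (Eventually.of_forall fun _ => norm_indicator_le_norm_self _ _)

/-- The projection `P_I f = χ_I f` on `L²(ℝⁿ)`, for a Lebesgue measurable set `I`. -/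
noncomputable def projTime {n : ℕ} {I : Set (EuclideanSpace ℝ (Fin n))}
    (hI : NullMeasurableSet I volume) : L2Rn n →L[ℂ] L2Rn n :=
  LinearMap.mkContinuous
    { toFun := fun f => (memLp_indicator hI f).toLp (I.indicator f)
      map_add' := fun f g => by
        rw [← MemLp.toLp_add, MemLp.toLp_eq_toLp_iff, ← Set.indicator_add']
        filter_upwards [Lp.coeFn_add f g] with x hx
        by_cases hxI : x ∈ I
        · rw [Set.indicator_of_mem hxI, Set.indicator_of_mem hxI, hx]
        · rw [Set.indicator_of_notMem hxI, Set.indicator_of_notMem hxI]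
      map_smul' := fun c f => by
        rw [RingHom.id_apply, ← MemLp.toLp_const_smul, MemLp.toLp_eq_toLp_iff]
        filter_upwards [Lp.coeFn_smul c f] with x hx
        by_cases hxI : x ∈ I <;> simp [hxI, hx] }
    1 (fun f => by
      rw [one_mul]
      refine Lp.norm_le_norm_of_ae_le ?_
      filter_upwards [(memLp_indicator hI f).coeFn_toLp] with x hx
      simp only [LinearMap.coe_mk, AddHom.coe_mk, hx]
      exact norm_indicator_le_norm_self _ _)

/-- The projection `Q_J f = (χ_J f̂)ˇ` on `L²(ℝⁿ)`, where `ˆ` is the Fourier-Plancherel transform. -/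
noncomputable def projFreq {n : ℕ} {J : Set (EuclideanSpace ℝ (Fin n))}
    (hJ : NullMeasurableSet J volume) : L2Rn n →L[ℂ] L2Rn n :=
  let F := (Lp.fourierTransformₗᵢ (EuclideanSpace ℝ (Fin n)) ℂ).toContinuousLinearEquiv
  (F.symm : L2Rn n →L[ℂ] L2Rn n) ∘L projTime hJ ∘L (F : L2Rn n →L[ℂ] L2Rn n)

section
variable {H : Type*} [NormedAddCommGroup H] [InnerProductSpace ℂ H]

/-- `X` is co-diagonal with respect to the projection `P`: both diagonal blocks vanish. -/
def IsCodiagonal (P X : H →L[ℂ] H) : Prop :=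
  P * X * P = 0 ∧ (1 - P) * X * (1 - P) = 0

/-- `X` is a selfadjoint operator of norm `π/2`, co-diagonal with respect to `P` and `Q`, such that
`e^{iX} P e^{-iX} = Q`: the exponent of a geodesic of length `π/2` from `P` to `Q`. -/
structure IsGeodesicExponent [CompleteSpace H] (P Q X : H →L[ℂ] H) : Prop where
  isSelfAdjoint : IsSelfAdjoint X
  norm_eq : ‖X‖ = Real.pi / 2
  codiagonal_left : IsCodiagonal P X
  codiagonal_right : IsCodiagonal Q X
  conj_eq : NormedSpace.exp (Complex.I • X) * P * NormedSpace.exp (-(Complex.I • X)) = Q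

/-- `R(P) ∩ N(Q) = {0}` and `N(P) ∩ R(Q) = {0}`. -/
def RangesMeetKernelsTrivially (P Q : H →L[ℂ] H) : Prop :=
  P.range ⊓ Q.ker = ⊥ ∧ P.ker ⊓ Q.range = ⊥

/-- The eigenspace `N(X - z)`. -/
def eigSpace (X : H →L[ℂ] H) (z : ℂ) : Submodule ℂ H :=
  Module.End.eigenspace (X : H →ₗ[ℂ] H) z

end

/-! Put S = 2P - 1 and T = 2Q - 1. Co-diagonality means SXS = -X, so S e^{iX} S = e^{-iX} and the
conjugation relation becomes e^{2iX} = TS. Hence cos² X = (P + Q - 1)² (`cfc_cos_mul_cfc_cos`),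
which is block diagonal for P with corner PQP. Since σ(X) lies in [-π/2, π/2], X² is a function of
this operator, and for 0 < t < π/2 the eigenvalues ±t of X correspond to the eigenvalue cos² t of
PQP; S exchanges the eigenspaces of t and -t.

Two analytic facts then decide the spectrum. First, PQP is compact, because Q_J P_I is
Hilbert-Schmidt for sets of finite measure (`isCompactOperator_projFreq_mul_projTime`). So the γ_k
accumulate only at π/2 and 0 is not an accumulation point of σ(X), which makes the range closed.
Second, PQP has infinite rank, because the Fourier transform of a nonzero function of bounded
support cannot vanish on a set of positive measure (`fourier_eq_zero_of_volume_ne_zero`). So there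
are infinitely many γ_k, and the same fact gives (*) for bounded sets.

Let R = P_{I₀} with I₀ essentially disjoint from I and of finite measure. Then QR is compact, so
(sin X)R and R(sin X) are compact, and so is [X, R], since X is a bounded multiple of sin X. If R
has infinite rank, the compactness of QR also forces N(X) to be infinite dimensional.

Under (*) the operator B = P + Q - 1 is injective. Then e^{iX} is determined by e^{iX}|B| = (TS +
1)/2, which gives uniqueness, while the polar decomposition B = W|B| gives the unitary WS, whose
logarithm is the operator sought. Its norm is exactly π/2 because |B| is not invertible. -/

section Reflections

/-! ### Reflections of two projections and the exponential of iX -/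

theorem reflection_mul_self {A : Type*} [Ring A] {p : A} (hp : p * p = p) :
    (2 * p - 1) * (2 * p - 1) = 1 := by
  have : (2 * p - 1) * (2 * p - 1) = 4 * (p * p) - 4 * p + 1 := by noncomm_ring
  rw [this, hp]; abel

theorem reflections_add {A : Type*} [Ring A] {p q : A} (hp : p * p = p) (hq : q * q = q) :
    (2 * q - 1) * (2 * p - 1) + (2 * p - 1) * (2 * q - 1) + 2 =
      4 * ((p + q - 1) * (p + q - 1)) := by
  have h1 : (p + q - 1) * (p + q - 1) = p * p + q * q + p * q + q * p - 2 * p - 2 * q + 1 := by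
    noncomm_ring
  rw [h1, hp, hq, show (4 : A) = 2 + 2 by norm_num, ← one_add_one_eq_two]; noncomm_ring

theorem sq_add_sub_one_mul {A : Type*} [Ring A] {p q : A} (hp : p * p = p) (hq : q * q = q) :
    (p + q - 1) * (p + q - 1) * p = p * q * p := by
  have h1 : (p + q - 1) * (p + q - 1) * p =
    p * p * p + q * q * p + p * q * p + q * (p * p) - 2 * (p * p) - 2 * (q * p) + p := by
    noncomm_ring
  rw [h1, hp, hq, hp]; noncomm_ring

theorem sq_add_sub_one_eq {A : Type*} [Ring A] {p q : A} (hp : p * p = p) (hq : q * q = q) :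
    (p + q - 1) * (p + q - 1) = p * q * p + (1 - p) * (1 - q) * (1 - p) := by
  have h1 : (p + q - 1) * (p + q - 1) = p * p + q * q + p * q + q * p - 2 * p - 2 * q + 1 := by
    noncomm_ring
  have h2 : (1 - p) * (1 - q) * (1 - p) =
    1 - 2 * p + p * p - q + p * q + q * p - p * q * p := by
    noncomm_ring
  rw [h1, h2, hp, hq]; noncomm_ring

variable {H : Type*} [NormedAddCommGroup H] [InnerProductSpace ℂ H]

/-- Conjugation by the reflection fixes the diagonal blocks and negates the off-diagonal ones. The
multiplicative form is the one that passes through the exponential. -/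
theorem isCodiagonal_iff {P X : H →L[ℂ] H} (hP : P * P = P) :
    IsCodiagonal P X ↔ (2 * P - 1) * X * (2 * P - 1) = -X := by
  have h2 : (2 * P - 1) * X * (2 * P - 1) =
    2 * (P * X * P) + 2 * ((1 - P) * X * (1 - P)) - X := by noncomm_ring
  constructor
  · rintro ⟨h, h'⟩
    rw [h2, h, h']; simp
  · intro h
    rw [h2] at h
    have h3 : (2 : ℂ) • (P * X * P + (1 - P) * X * (1 - P)) = 0 := by
      rw [two_smul]
      have : 2 * (P * X * P) + 2 * ((1 - P) * X * (1 - P)) = 0 := by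
        have := congrArg (· + X) h
        simpa using this
      rw [← this]; noncomm_ring
    have h4 := (smul_eq_zero.mp h3).resolve_left two_ne_zero
    have h5 : P * X * P = 0 := by
      have e1 : P * (P * X * P + (1 - P) * X * (1 - P)) * P =
        (P * P) * X * (P * P) + (P - P * P) * X * (P - P * P) := by noncomm_ring
      rw [h4, hP] at e1
      simpa using e1.symm
    exact ⟨h5, by simpa [h5] using h4⟩

variable [CompleteSpace H]

theorem exp_conj_of_mul_self_eq_one {S X : H →L[ℂ] H} (hS : S * S = 1) :
    NormedSpace.exp (S * X * S) = S * NormedSpace.exp X * S := by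
  let +nondep : NormedAlgebra ℚ (H →L[ℂ] H) := .restrictScalars ℚ ℂ _
  exact NormedSpace.exp_units_conj (⟨S, S, hS, hS⟩ : (H →L[ℂ] H)ˣ) X

theorem exp_mul_exp_neg' (Y : H →L[ℂ] H) : NormedSpace.exp Y * NormedSpace.exp (-Y) = 1 := by
  let +nondep : NormedAlgebra ℚ (H →L[ℂ] H) := .restrictScalars ℚ ℂ _
  rw [← NormedSpace.exp_add_of_commute (Commute.neg_right (Commute.refl Y))]
  simp

theorem exp_neg_mul_exp' (Y : H →L[ℂ] H) : NormedSpace.exp (-Y) * NormedSpace.exp Y = 1 := by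
  simpa using exp_mul_exp_neg' (-Y)

theorem star_exp_I_smul {X : H →L[ℂ] H} (hX : IsSelfAdjoint X) :
    star (NormedSpace.exp (Complex.I • X)) = NormedSpace.exp (-(Complex.I • X)) := by
  rw [NormedSpace.star_exp, star_smul, hX.star_eq]
  simp

theorem exp_I_smul_eq {X : H →L[ℂ] H} (hX : IsSelfAdjoint X) :
    NormedSpace.exp (Complex.I • X) = cfc Real.cos X + Complex.I • cfc Real.sin X := by
  have hn : IsStarNormal X := hX.isStarNormal
  rw [← CFC.exp_eq_normedSpace_exp (𝕜 := ℂ) (a := Complex.I • X)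
      (ha := by rw [isStarNormal_iff]; simp [star_smul, hX.star_eq, Commute.refl]),
    ← cfc_comp_smul Complex.I _ X (by rw [← Complex.exp_eq_exp_ℂ]; fun_prop) hn,
    cfc_real_eq_complex _ hX, cfc_real_eq_complex _ hX,
    ← cfc_smul Complex.I _ X, ← cfc_add _ _ _]
  refine cfc_congr fun z hz => ?_
  have hz' : z = (z.re : ℂ) := (hX.spectrumRestricts.rightInvOn hz).symm
  rw [hz', ← Complex.exp_eq_exp_ℂ]
  simp only [smul_eq_mul, Complex.ofReal_re, Complex.ofReal_cos, Complex.ofReal_sin]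
  rw [mul_comm, Complex.exp_mul_I]
  ring

theorem exp_neg_I_smul_eq {X : H →L[ℂ] H} (hX : IsSelfAdjoint X) :
    NormedSpace.exp (-(Complex.I • X)) = cfc Real.cos X - Complex.I • cfc Real.sin X := by
  rw [← star_exp_I_smul hX, exp_I_smul_eq hX]
  simp [star_smul, (cfc_predicate Real.cos X : IsSelfAdjoint _).star_eq,
    (cfc_predicate Real.sin X : IsSelfAdjoint _).star_eq, sub_eq_add_neg]

namespace IsGeodesicExponent

variable {P Q X : H →L[ℂ] H}

/-- With U = e^{iX}, co-diagonality gives U⁻¹ = SUS, so T = U S U⁻¹ = U S (SUS) = U²S. -/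
theorem exp_mul_exp (h : IsGeodesicExponent P Q X) (hP : P * P = P) :
    NormedSpace.exp (Complex.I • X) * NormedSpace.exp (Complex.I • X) =
      (2 * Q - 1) * (2 * P - 1) := by
  set U := NormedSpace.exp (Complex.I • X) with hU
  set V := NormedSpace.exp (-(Complex.I • X)) with hV
  set S := 2 * P - 1 with hS
  have hSS : S * S = 1 := reflection_mul_self hP
  have hUV : U * V = 1 := exp_mul_exp_neg' _
  have hSU : V = S * U * S := by
    rw [hU, hV, ← exp_conj_of_mul_self_eq_one hSS, mul_smul_comm, smul_mul_assoc,
      (isCodiagonal_iff hP).1 h.codiagonal_left, smul_neg]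
  have hT : U * S * V = 2 * Q - 1 := by
    rw [← h.conj_eq, hS, mul_sub, sub_mul, mul_one, hUV]
    noncomm_ring
  rw [← hT, hSU]
  calc U * U = U * (S * S) * U * (S * S) := by simp [hSS]
    _ = _ := by noncomm_ring

theorem exp_neg_mul_exp_neg (h : IsGeodesicExponent P Q X) (hP : IsStarProjection P)
    (hQ : IsStarProjection Q) :
    NormedSpace.exp (-(Complex.I • X)) * NormedSpace.exp (-(Complex.I • X)) =
      (2 * P - 1) * (2 * Q - 1) := by
  have := congrArg star (h.exp_mul_exp hP.isIdempotentElem)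
  rw [star_mul, star_exp_I_smul h.isSelfAdjoint, star_mul] at this
  rw [this]
  simp [star_sub, star_mul, hP.isSelfAdjoint.star_eq, hQ.isSelfAdjoint.star_eq,
    (Commute.ofNat_right P 2).eq, (Commute.ofNat_right Q 2).eq]

/-- (2 cos X)² = e^{2iX} + e^{-2iX} + 2 = TS + ST + 2, and the right side is polynomial in P and Q.
-/
theorem cfc_cos_mul_cfc_cos (h : IsGeodesicExponent P Q X) (hP : IsStarProjection P)
    (hQ : IsStarProjection Q) :
    cfc Real.cos X * cfc Real.cos X = (P + Q - 1) * (P + Q - 1) := by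
  set U := NormedSpace.exp (Complex.I • X) with hU
  set V := NormedSpace.exp (-(Complex.I • X)) with hV
  have hUV : U * V = 1 := exp_mul_exp_neg' _
  have hVU : V * U = 1 := exp_neg_mul_exp' _
  have h2 : U + V = (2 : ℂ) • cfc Real.cos X := by
    rw [hU, hV, exp_I_smul_eq h.isSelfAdjoint, exp_neg_I_smul_eq h.isSelfAdjoint, two_smul]
    abel
  have h3 : (U + V) * (U + V) = 4 * ((P + Q - 1) * (P + Q - 1)) := by
    rw [← reflections_add hP.isIdempotentElem hQ.isIdempotentElem,
      ← h.exp_mul_exp hP.isIdempotentElem, ← h.exp_neg_mul_exp_neg hP hQ]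
    rw [mul_add, add_mul, add_mul, hUV, hVU, ← one_add_one_eq_two]
    abel
  rw [h2, smul_mul_smul_comm] at h3
  have h4 : (4 : H →L[ℂ] H) * ((P + Q - 1) * (P + Q - 1)) =
      (2 * 2 : ℂ) • ((P + Q - 1) * (P + Q - 1)) := by
    rw [Algebra.smul_def, show (2 * 2 : ℂ) = 4 by norm_num, map_ofNat]
  rw [h4] at h3
  exact smul_right_injective _ (by norm_num : (2 * 2 : ℂ) ≠ 0) h3

end IsGeodesicExponent
end Reflections

/-! ### Eigenvalues of compact symmetric operators -/

section CompactOperators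
variable {H : Type*} [NormedAddCommGroup H] [InnerProductSpace ℂ H]

theorem IsCompactOperator.mul_clm {A : H →L[ℂ] H} (hA : IsCompactOperator A) (B : H →L[ℂ] H) :
    IsCompactOperator (A * B) := hA.comp_clm B

theorem IsCompactOperator.clm_mul {A : H →L[ℂ] H} (hA : IsCompactOperator A) (B : H →L[ℂ] H) :
    IsCompactOperator (B * A) := hA.clm_comp B

theorem isCompactOperator_of_finiteDimensional_range (T : H →L[ℂ] H)
    [FiniteDimensional ℂ T.range] : IsCompactOperator T := by
  have : ProperSpace T.range := FiniteDimensional.proper ℂ _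
  have h : IsCompactOperator (T.codRestrict T.range fun x => ⟨x, rfl⟩) :=
    isCompactOperator_of_locallyCompactSpace_dom (T.codRestrict T.range fun x => ⟨x, rfl⟩)
  exact h.clm_comp T.range.subtypeL

theorem IsCompactOperator.finiteDimensional_range_of_isIdempotentElem [CompleteSpace H]
    {E : H →L[ℂ] H} (hc : IsCompactOperator E) (hE : E * E = E) :
    FiniteDimensional ℂ E.range := by
  have h := ContinuousLinearMap.finite_dimensional_eigenspace hc 1 one_ne_zero
  have : E.range ≤ Module.End.eigenspace E.toLinearMap 1 := by
    rintro _ ⟨x, rfl⟩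
    rw [Module.End.mem_eigenspace_iff, one_smul]
    exact congrArg (· x) hE
  exact Submodule.finiteDimensional_of_le this

/-- Unit eigenvectors for distinct eigenvalues are orthogonal, so their images are at mutual
distance at least ε; an infinite family would have no convergent subsequence of images. -/
theorem finite_setOf_hasEigenvalue_of_isCompactOperator {T : H →L[ℂ] H}
    (hT : IsCompactOperator T) (hs : (T : H →ₗ[ℂ] H).IsSymmetric) {ε : ℝ} (hε : 0 < ε) :
    {μ : ℂ | ε ≤ ‖μ‖ ∧ Module.End.HasEigenvalue (T : H →ₗ[ℂ] H) μ}.Finite := by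
  by_contra hinf
  have hinf : {μ : ℂ | ε ≤ ‖μ‖ ∧ Module.End.HasEigenvalue (T : H →ₗ[ℂ] H) μ}.Infinite := hinf
  obtain ⟨μ, hμ⟩ : Nonempty (ℕ ↪ {μ : ℂ | ε ≤ ‖μ‖ ∧
      Module.End.HasEigenvalue (T : H →ₗ[ℂ] H) μ}) := ⟨hinf.natEmbedding⟩
  have hex : ∀ k, ∃ v : H, ‖v‖ = 1 ∧ T v = (μ k : ℂ) • v := by
    intro k
    obtain ⟨v, hv⟩ := (μ k).2.2.exists_hasEigenvector
    refine ⟨((‖v‖⁻¹ : ℝ) : ℂ) • v, ?_, ?_⟩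
    · rw [norm_smul]
      simp [norm_ne_zero_iff.2 hv.2]
    · rw [map_smul, smul_comm, show T v = _ from hv.apply_eq_smul]
  choose v hv1 hv using hex
  have horth : ∀ j k, j ≠ k → inner ℂ (v j) (v k) = 0 := by
    intro j k hjk
    have hne : (μ j : ℂ) ≠ μ k := fun h => hjk (hμ (Subtype.ext h))
    exact hs.orthogonalFamily_eigenspaces hne
      ⟨v j, Module.End.mem_eigenspace_iff.2 (hv j)⟩ ⟨v k, Module.End.mem_eigenspace_iff.2 (hv k)⟩
  obtain ⟨K, hK, hK'⟩ := hT.image_closedBall_subset_compact 1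
  obtain ⟨y, hyK, ψ, hψ, hψy⟩ := hK.tendsto_subseq
    (fun n => hK' ⟨v n, by simp [hv1], rfl⟩)
  replace hψy := hψy.cauchySeq
  rw [Metric.cauchySeq_iff'] at hψy
  obtain ⟨N, hN⟩ := hψy ε hε
  have h1 := hN (N + 1) (by simp)
  have hne : ψ (N + 1) ≠ ψ N := (hψ (Nat.lt_succ_self N)).ne'
  rw [dist_eq_norm] at h1
  change ‖T (v (ψ (N + 1))) - T (v (ψ N))‖ < ε at h1
  rw [hv, hv] at h1
  have h2 : ‖(μ (ψ (N + 1)) : ℂ) • v (ψ (N + 1)) - (μ (ψ N) : ℂ) • v (ψ N)‖ ^ 2 =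
      ‖(μ (ψ (N + 1)) : ℂ)‖ ^ 2 + ‖(μ (ψ N) : ℂ)‖ ^ 2 := by
    have := @norm_sub_sq ℂ H _ _ _ ((μ (ψ (N + 1)) : ℂ) • v (ψ (N + 1)))
      ((μ (ψ N) : ℂ) • v (ψ N))
    rw [this, inner_smul_left, inner_smul_right, horth _ _ hne]
    simp [norm_smul, hv1]
  have h3 := (μ (ψ (N + 1))).2.1
  have h4 : ‖(μ (ψ (N + 1)) : ℂ)‖ ^ 2 < ε ^ 2 := by
    calc _ ≤ ‖(μ (ψ (N + 1)) : ℂ) • v (ψ (N + 1)) - (μ (ψ N) : ℂ) • v (ψ N)‖ ^ 2 := by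
          rw [h2]; nlinarith [sq_nonneg ‖(μ (ψ N) : ℂ)‖]
      _ < ε ^ 2 := by gcongr
  exact absurd (lt_of_pow_lt_pow_left₀ 2 hε.le h4) (not_lt.2 h3)

/-- The eigenspaces span a dense subspace. With finitely many nonzero eigenvalues, T would map it,
hence all of H, into a finite sum of finite dimensional eigenspaces. -/
theorem infinite_setOf_hasEigenvalue_of_isCompactOperator [CompleteSpace H] {T : H →L[ℂ] H}
    (hT : IsCompactOperator T) (hs : (T : H →ₗ[ℂ] H).IsSymmetric)
    (hr : ¬ FiniteDimensional ℂ T.range) :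
    {μ : ℂ | μ ≠ 0 ∧ Module.End.HasEigenvalue (T : H →ₗ[ℂ] H) μ}.Infinite := by
  intro hfin
  apply hr
  set s := {μ : ℂ | μ ≠ 0 ∧ Module.End.HasEigenvalue (T : H →ₗ[ℂ] H) μ} with hsdef
  have := hfin.to_subtype
  let V : Submodule ℂ H := ⨆ μ : s, Module.End.eigenspace (T : H →ₗ[ℂ] H) (μ : ℂ)
  have hfd : ∀ μ : s, FiniteDimensional ℂ (Module.End.eigenspace (T : H →ₗ[ℂ] H) (μ : ℂ)) :=
    fun μ => ContinuousLinearMap.finite_dimensional_eigenspace hT _ μ.2.1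
  have hV : FiniteDimensional ℂ V := Submodule.finiteDimensional_iSup _
  have htop := Submodule.topologicalClosure_eq_top_iff.2
    (ContinuousLinearMap.orthogonalComplement_iSup_eigenspaces_eq_bot hT hs)
  have hle : (⨆ μ, Module.End.eigenspace (T : H →ₗ[ℂ] H) μ) ≤ V.comap (T : H →ₗ[ℂ] H) := by
    refine iSup_le fun μ x hx => ?_
    have hx' : T x = μ • x := Module.End.mem_eigenspace_iff.1 hx
    rw [Submodule.mem_comap]
    change T x ∈ V
    rw [hx']
    by_cases hμ : μ = 0
    · simp [hμ]
    by_cases hx0 : x = 0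
    · simp [hx0]
    · refine V.smul_mem _ ?_
      exact Submodule.mem_iSup_of_mem
        (⟨μ, hμ, Module.End.hasEigenvalue_of_hasEigenvector ⟨hx, hx0⟩⟩ : s) hx
  have hcl : IsClosed ((V.comap (T : H →ₗ[ℂ] H) : Submodule ℂ H) : Set H) :=
    (Submodule.closed_of_finiteDimensional V).preimage T.continuous
  have h2 : (⊤ : Submodule ℂ H) ≤ V.comap (T : H →ₗ[ℂ] H) := by
    rw [← htop]
    exact Submodule.topologicalClosure_minimal _ hle hcl
  have h3 : T.range ≤ V := by
    rintro _ ⟨x, rfl⟩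
    exact h2 (Submodule.mem_top (x := x))
  exact Submodule.finiteDimensional_of_le h3

theorem aeval_apply_of_apply_eq_smul {T : H →L[ℂ] H} {v : H} {l : ℝ} (hv : T v = (l : ℂ) • v)
    (p : Polynomial ℝ) : Polynomial.aeval T p v = ((p.eval l : ℝ) : ℂ) • v := by
  induction p using Polynomial.induction_on' with
  | add p q hp hq => simp [hp, hq, add_smul]
  | monomial n a =>
    have : ∀ n : ℕ, (T ^ n) v = ((l : ℂ) ^ n) • v := by
      intro n
      induction n with
      | zero => simp
      | succ n ih =>
        rw [pow_succ, mul_apply_eq_comp, hv, map_smul, ih, smul_smul, pow_succ,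
          mul_comm]
    rw [Polynomial.aeval_monomial, mul_apply_eq_comp, this, Polynomial.eval_monomial,
      Algebra.algebraMap_eq_smul_one]
    simp [mul_smul, smul_comm a]

end CompactOperators

/-! ### Continuous functional calculus on eigenvectors -/

section FunctionalCalculus
variable {H : Type*} [NormedAddCommGroup H] [InnerProductSpace ℂ H] [CompleteSpace H]

theorem abs_le_norm_of_mem_spectrum_real {T : H →L[ℂ] H} {x : ℝ} (hx : x ∈ spectrum ℝ T) :
    |x| ≤ ‖T‖ := by
  rcases subsingleton_or_nontrivial (H →L[ℂ] H) with h | h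
  · simp [spectrum.of_subsingleton] at hx
  · exact spectrum.norm_le_norm_of_mem hx

/-- True for polynomials, then by Weierstrass approximation on [-‖T‖, ‖T‖], an interval containing
both the spectrum and the eigenvalue. -/
theorem cfc_apply_of_apply_eq_smul {T : H →L[ℂ] H} (hT : IsSelfAdjoint T) {f : ℝ → ℝ}
    (hf : Continuous f) {v : H} {l : ℝ} (hv : T v = (l : ℂ) • v) :
    cfc f T v = ((f l : ℝ) : ℂ) • v := by
  by_cases hv0 : v = 0
  · simp [hv0]
  have hv0' : 0 < ‖v‖ := norm_pos_iff.2 hv0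
  have hl : |l| ≤ ‖T‖ := by
    have := T.le_opNorm v
    rw [hv, norm_smul, Complex.norm_real, Real.norm_eq_abs] at this
    exact le_of_mul_le_mul_right this hv0'
  rw [← sub_eq_zero, ← norm_eq_zero]
  refine le_antisymm (le_of_forall_pos_le_add fun ε hε => ?_) (norm_nonneg _)
  obtain ⟨p, hp⟩ := exists_polynomial_near_of_continuousOn (-‖T‖) ‖T‖ f hf.continuousOn
    (ε / (2 * ‖v‖)) (by positivity)
  have h1 : ‖cfc f T - Polynomial.aeval T p‖ ≤ ε / (2 * ‖v‖) := by
    rw [← cfc_polynomial p T, ← cfc_sub ..]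
    refine norm_cfc_le (by positivity) fun x hx => ?_
    have := hp x (abs_le.1 (abs_le_norm_of_mem_spectrum_real hx))
    rw [Real.norm_eq_abs, abs_sub_comm]
    exact this.le
  have h2 : cfc f T v - ((f l : ℝ) : ℂ) • v =
      (cfc f T - Polynomial.aeval T p) v + ((p.eval l - f l : ℝ) : ℂ) • v := by
    rw [_root_.sub_apply, aeval_apply_of_apply_eq_smul hv, Complex.ofReal_sub,
      sub_smul]
    abel
  rw [h2, zero_add]
  calc _ ≤ ‖(cfc f T - Polynomial.aeval T p) v‖ + ‖((p.eval l - f l : ℝ) : ℂ) • v‖ :=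
        norm_add_le _ _
    _ ≤ ε / (2 * ‖v‖) * ‖v‖ + ε / (2 * ‖v‖) * ‖v‖ := by
        refine add_le_add ?_ ?_
        · exact (ContinuousLinearMap.le_opNorm _ _).trans (by gcongr)
        · rw [norm_smul, Complex.norm_real, Real.norm_eq_abs]
          gcongr
          exact (hp l (abs_le.1 hl)).le
    _ = ε := by field_simp; ring

end FunctionalCalculus

/-! ### Algebraic spectrum of the two corners of (p + q - 1)² -/

section CornerSpectrum
variable {A : Type*} [Ring A] [Algebra ℂ A]

theorem notMem_spectrum_idempotent_sub {e a : A} (he : e * e = e) (h2 : a * e = a)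
    {μ : ℂ} (h0 : μ ≠ 0) (h1 : μ ≠ 1) (h : μ ∉ spectrum ℂ a) : 1 - μ ∉ spectrum ℂ (e - a) := by
  rw [spectrum.notMem_iff] at h ⊢
  -- On the complement of e the factorization below requires -μc = 1 - μ; the hypothesis μ ≠ 1 makes
  -- c invertible.
  set c : ℂ := -(1 - μ) / μ with hc
  have hc0 : c ≠ 0 := div_ne_zero (neg_ne_zero.2 (sub_ne_zero.2 h1.symm)) h0
  have key : ∀ s t : ℂ, (e + s • (1 - e)) * (e + t • (1 - e)) = e + (s * t) • (1 - e) := by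
    intro s t
    have i1 : e * (1 - e) = 0 := by rw [mul_sub, mul_one, he, sub_self]
    have i2 : (1 - e) * e = 0 := by rw [sub_mul, one_mul, he, sub_self]
    have i3 : (1 - e) * (1 - e) = 1 - e := by rw [mul_sub, mul_one, i2, sub_zero]
    rw [mul_add, add_mul, add_mul, mul_smul_comm, smul_mul_assoc, smul_mul_smul_comm, i1, i2, i3,
      he]
    simp
  have hu : IsUnit (e + c • (1 - e)) :=
    ⟨⟨e + c • (1 - e), e + c⁻¹ • (1 - e), by rw [key, mul_inv_cancel₀ hc0]; simp,
      by rw [key, inv_mul_cancel₀ hc0]; simp⟩, rfl⟩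
  have : algebraMap ℂ A (1 - μ) - (e - a) = -((algebraMap ℂ A μ - a) * (e + c • (1 - e))) := by
    have i1 : a * (1 - e) = 0 := by rw [mul_sub, mul_one, h2, sub_self]
    rw [Algebra.algebraMap_eq_smul_one, Algebra.algebraMap_eq_smul_one, mul_add, sub_mul, sub_mul,
      mul_smul_comm, mul_smul_comm, i1, h2, smul_mul_assoc, one_mul, smul_mul_assoc, one_mul,
      smul_smul, hc, div_mul_cancel₀ _ h0]
    module
  rw [this]
  exact (h.mul hu).neg

theorem notMem_spectrum_add_of_mul_eq_zero {a b : A} (hab : a * b = 0) {μ : ℂ} (h0 : μ ≠ 0)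
    (ha : μ ∉ spectrum ℂ a) (hb : μ ∉ spectrum ℂ b) : μ ∉ spectrum ℂ (a + b) := by
  rw [spectrum.notMem_iff] at *
  have : algebraMap ℂ A μ - (a + b) =
      algebraMap ℂ A μ⁻¹ * ((algebraMap ℂ A μ - a) * (algebraMap ℂ A μ - b)) := by
    simp only [Algebra.algebraMap_eq_smul_one, mul_sub, sub_mul, smul_mul_assoc, one_mul,
      mul_smul_comm, mul_one, hab, smul_sub, smul_smul]
    match_scalars <;> field_simp
  rw [this]
  exact ((IsUnit.mk0 _ (inv_ne_zero h0)).map (algebraMap ℂ A)).mul (ha.mul hb)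

/-- The square is the block sum of pqp and (1-p)(1-q)(1-p), and away from 0 and 1 the second block
has no spectrum beyond that of the first. The passage between the corners uses σ(ab) \ {0} = σ(ba) \
{0} twice and μ ↦ 1 - μ twice: pqp, qpq, q(1-p)q, (1-p)q(1-p), (1-p)(1-q)(1-p). -/
theorem mem_spectrum_corner_of_mem_spectrum_sq {p q : A} (hp : p * p = p) (hq : q * q = q) {μ : ℂ}
    (h0 : μ ≠ 0) (h1 : μ ≠ 1) (h : μ ∈ spectrum ℂ ((p + q - 1) * (p + q - 1))) :
    μ ∈ spectrum ℂ (p * q * p) := by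
  by_contra hn
  have swap : ∀ (a b : A) (ν : ℂ), ν ≠ 0 → ν ∉ spectrum ℂ (a * b) → ν ∉ spectrum ℂ (b * a) := by
    intro a b ν hν hab hba
    have : ν ∈ spectrum ℂ (b * a) \ {0} := ⟨hba, hν⟩
    rw [spectrum.nonzero_mul_comm] at this
    exact hab this.1
  have h1' : (1 : ℂ) - μ ≠ 0 := sub_ne_zero.2 h1.symm
  have hp' : (1 - p) * (1 - p) = 1 - p := by rw [mul_sub, mul_one, sub_mul, one_mul, hp]; simp
  have e1 : p * q * p = (p * q) * (q * p) := by
    rw [mul_assoc p q (q * p), ← mul_assoc q q p, hq, mul_assoc]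
  have e2 : (q * p) * (p * q) = q * p * q := by
    rw [mul_assoc q p (p * q), ← mul_assoc p p q, hp, mul_assoc]
  rw [e1] at hn
  have s1 := swap _ _ _ h0 hn
  rw [e2] at s1
  have s2 := notMem_spectrum_idempotent_sub hq (by rw [mul_assoc, hq]) h0 h1 s1
  have e3 : q - q * p * q = (q * (1 - p)) * ((1 - p) * q) := by
    rw [mul_assoc q (1 - p) _, ← mul_assoc (1 - p) (1 - p) q, hp']
    rw [sub_mul, one_mul, mul_sub, hq, mul_assoc]
  rw [e3] at s2
  have s3 := swap _ _ _ h1' s2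
  have e4 : (1 - p) * q * (q * (1 - p)) = (1 - p) * q * (1 - p) := by
    rw [mul_assoc, ← mul_assoc q q, hq, mul_assoc]
  rw [e4] at s3
  have s4 := notMem_spectrum_idempotent_sub hp' (by rw [mul_assoc, hp']) h1' (by simpa using h0) s3
  have e5 : 1 - p - (1 - p) * q * (1 - p) = (1 - p) * (1 - q) * (1 - p) := by
    rw [mul_sub (1 - p) 1 q, mul_one, sub_mul (1 - p), hp']
  rw [e5, sub_sub_cancel] at s4
  rw [sq_add_sub_one_eq hp hq] at h
  refine notMem_spectrum_add_of_mul_eq_zero ?_ h0 (e1 ▸ hn) s4 h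
  have : p * (1 - p) = 0 := by rw [mul_sub, mul_one, hp, sub_self]
  rw [mul_assoc (1 - p), mul_assoc (p * q), ← mul_assoc p (1 - p), this]
  simp

end CornerSpectrum

theorem mul_sq_add_sub_one {A : Type*} [Ring A] {p q : A} (hp : p * p = p) (hq : q * q = q) :
    p * ((p + q - 1) * (p + q - 1)) = p * q * p := by
  have h1 : p * ((p + q - 1) * (p + q - 1)) =
    p * p * p + p * (q * q) + p * p * q + p * q * p - 2 * (p * p) - 2 * (p * q) + p := by
    noncomm_ring
  rw [h1, hp, hq, hp]; noncomm_ring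

/-- Counting the elements of S below a given one is a strictly increasing map to ℕ, so S has the
order type of an infinite subset of ℕ. -/
theorem exists_strictMono_range_eq {S : Set ℝ} {b : ℝ} (hS : S.Infinite) (hb : ∀ x ∈ S, x < b)
    (hfin : ∀ r < b, (S ∩ Set.Iic r).Finite) :
    ∃ γ : ℕ → ℝ, StrictMono γ ∧ Set.range γ = S ∧ Tendsto γ atTop (𝓝 b) := by
  let f : S → ℕ := fun s => (S ∩ Set.Iio (s : ℝ)).ncard
  have hf : StrictMono f := by
    intro s t hst
    have hst' : (s : ℝ) < t := hst
    refine Set.ncard_lt_ncard ?_ ((hfin t (hb t t.2)).subset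
      (Set.inter_subset_inter_right _ Set.Iio_subset_Iic_self))
    refine (Set.ssubset_iff_of_subset ?_).2 ⟨s, ⟨s.2, hst'⟩, fun h => lt_irrefl (s : ℝ) h.2⟩
    exact Set.inter_subset_inter_right _ (Set.Iio_subset_Iio hst'.le)
  have : Infinite S := hS.to_subtype
  have : Infinite (Set.range f) := (Set.infinite_range_of_injective hf.injective).to_subtype
  classical
  let e : ℕ ≃o S := (Nat.Subtype.orderIsoOfNat (Set.range f)).trans (hf.orderIso f).symm
  have hmono : StrictMono fun n => (e n : ℝ) := fun m n hmn => e.strictMono hmn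
  refine ⟨fun n => e n, hmono, ?_, ?_⟩
  · ext x
    refine ⟨?_, fun hx => ⟨e.symm ⟨x, hx⟩, by simp⟩⟩
    rintro ⟨n, rfl⟩
    exact (e n).2
  · refine tendsto_order.2 ⟨fun r hr => ?_, fun r hr => Eventually.of_forall fun n =>
      (hb _ (e n).2).trans hr⟩
    have h1 : {n : ℕ | (e n : ℝ) ≤ r}.Finite :=
      ((hfin r hr).preimage hmono.injective.injOn).subset fun n hn => ⟨(e n).2, hn⟩
    have h2 := h1.eventually_cofinite_notMem
    rw [Nat.cofinite_eq_atTop] at h2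
    filter_upwards [h2] with n hn
    exact not_le.1 hn

/-! ### Correspondence between the eigenvalues of X and of PQP -/

namespace IsGeodesicExponent
variable {H : Type*} [NormedAddCommGroup H] [InnerProductSpace ℂ H] [CompleteSpace H]
  {P Q X : H →L[ℂ] H}

theorem abs_le_of_mem_spectrum (h : IsGeodesicExponent P Q X) {t : ℝ} (ht : t ∈ spectrum ℝ X) :
    |t| ≤ Real.pi / 2 := h.norm_eq ▸ abs_le_norm_of_mem_spectrum_real ht

theorem cfc_cos_sq (h : IsGeodesicExponent P Q X) (hP : IsStarProjection P)
    (hQ : IsStarProjection Q) :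
    cfc (fun t => Real.cos t ^ 2) X = (P + Q - 1) * (P + Q - 1) := by
  rw [← h.cfc_cos_mul_cfc_cos hP hQ, ← cfc_mul ..]
  exact cfc_congr fun t _ => pow_two _

theorem eq_mul_add_mul (h : IsGeodesicExponent P Q X) : X = P * X + X * P := by
  obtain ⟨h1, h2⟩ := h.codiagonal_left
  have : (1 - P) * X * (1 - P) = X - P * X - X * P + P * X * P := by noncomm_ring
  rw [this, h1, add_zero, sub_sub, sub_eq_zero] at h2
  exact h2

theorem sq_apply (h : IsGeodesicExponent P Q X) (hP : IsStarProjection P)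
    (hQ : IsStarProjection Q) {v : H} {t : ℝ} (hv : X v = (t : ℂ) • v) :
    (P + Q - 1) ((P + Q - 1) v) = ((Real.cos t ^ 2 : ℝ) : ℂ) • v := by
  have := cfc_apply_of_apply_eq_smul h.isSelfAdjoint (f := fun t => Real.cos t ^ 2)
    (by fun_prop) hv
  rw [h.cfc_cos_sq hP hQ] at this
  exact this

theorem corner_apply (h : IsGeodesicExponent P Q X) (hP : IsStarProjection P)
    (hQ : IsStarProjection Q) {v : H} {t : ℝ} (hv : X v = (t : ℂ) • v) :
    (P * Q * P) (P v) = ((Real.cos t ^ 2 : ℝ) : ℂ) • P v := by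
  have h1 := congrArg P (h.sq_apply hP hQ hv)
  rw [map_smul] at h1
  rw [← h1]
  have h2 : P * ((P + Q - 1) * (P + Q - 1)) = P * Q * P * P := by
    rw [mul_sq_add_sub_one hP.isIdempotentElem hQ.isIdempotentElem, mul_assoc (P * Q),
      hP.isIdempotentElem.eq]
  exact congrArg (· v) h2.symm

/-- X = PX + XP, so Pv = 0 would give Xv = P(Xv) = tPv = 0. This is what bounds multiplicities for X
by multiplicities for PQP. -/
theorem apply_ne_zero (h : IsGeodesicExponent P Q X)
    {v : H} {t : ℝ} (ht : t ≠ 0) (hv : X v = (t : ℂ) • v) (hv0 : v ≠ 0) : P v ≠ 0 := by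
  intro hPv
  have h1 : X v = P (X v) + X (P v) := congrArg (· v) h.eq_mul_add_mul
  rw [hPv, hv, map_smul, hPv] at h1
  simp [hv0, ht] at h1

/-- On [-π/2, π/2] the map s ↦ arccos √s turns cos² t into |t|. The sign is lost, so only X² is
recovered. -/
theorem cfc_arccos_sqrt_sq (h : IsGeodesicExponent P Q X) (hP : IsStarProjection P)
    (hQ : IsStarProjection Q) :
    cfc (fun s => Real.arccos (Real.sqrt s) ^ 2) ((P + Q - 1) * (P + Q - 1)) = X * X := by
  have hX := h.isSelfAdjoint
  have hc : Continuous fun s : ℝ => Real.arccos (Real.sqrt s) ^ 2 := by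
    have := Real.continuous_arccos
    fun_prop
  rw [← h.cfc_cos_sq hP hQ, ← cfc_comp (fun s => Real.arccos (Real.sqrt s) ^ 2)
    (fun t => Real.cos t ^ 2) X]
  conv_rhs => rw [← cfc_id' ℝ X, ← cfc_mul ..]
  refine cfc_congr fun t ht => ?_
  have ht' := h.abs_le_of_mem_spectrum ht
  have h0 : 0 ≤ Real.cos |t| := Real.cos_nonneg_of_neg_pi_div_two_le_of_le
    (by linarith [abs_nonneg t, Real.pi_pos]) ht'
  simp only [Function.comp_apply]
  rw [← Real.cos_abs, Real.sqrt_sq h0, Real.arccos_cos (abs_nonneg t)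
    (by linarith [Real.pi_pos]), sq_abs, pow_two]

theorem hasEigenvalue_of_hasEigenvalue_corner (h : IsGeodesicExponent P Q X)
    (hP : IsStarProjection P) (hQ : IsStarProjection Q) {t : ℝ} (h0 : 0 < t)
    (h1 : t < Real.pi / 2)
    (he : Module.End.HasEigenvalue ((P * Q * P : H →L[ℂ] H) : H →ₗ[ℂ] H)
      ((Real.cos t ^ 2 : ℝ) : ℂ)) :
    Module.End.HasEigenvalue (X : H →ₗ[ℂ] H) (t : ℂ) := by
  obtain ⟨g, hg⟩ := he.exists_hasEigenvector
  have hg' : P (Q (P g)) = ((Real.cos t ^ 2 : ℝ) : ℂ) • g := hg.apply_eq_smul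
  have hcos : 0 < Real.cos t := Real.cos_pos_of_mem_Ioo ⟨by linarith, h1⟩
  have hc0 : ((Real.cos t ^ 2 : ℝ) : ℂ) ≠ 0 := by
    exact_mod_cast (pow_pos hcos 2).ne'
  have hPP : ∀ x, P (P x) = P x := fun x => congrArg (· x) hP.isIdempotentElem.eq
  have hPg : P g = g := by
    have := congrArg P hg'
    rw [hPP, map_smul, hg'] at this
    exact (smul_right_injective H hc0 this).symm
  have hB : ((P + Q - 1) * (P + Q - 1)) g = ((Real.cos t ^ 2 : ℝ) : ℂ) • g := by
    rw [← hg']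
    conv_lhs => rw [← hPg]
    exact congrArg (· g) (sq_add_sub_one_mul hP.isIdempotentElem.eq hQ.isIdempotentElem.eq)
  have hsa : IsSelfAdjoint ((P + Q - 1) * (P + Q - 1)) := by
    rw [← h.cfc_cos_sq hP hQ]; exact cfc_predicate _ _
  have hXX : X (X g) = ((t ^ 2 : ℝ) : ℂ) • g := by
    have := cfc_apply_of_apply_eq_smul hsa (f := fun s => Real.arccos (Real.sqrt s) ^ 2)
      (by have := Real.continuous_arccos; fun_prop) hB
    rw [h.cfc_arccos_sqrt_sq hP hQ] at this
    refine this.trans ?_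
    rw [Real.sqrt_sq hcos.le, Real.arccos_cos h0.le (by linarith)]
  have ht0 : (t : ℂ) ≠ 0 := by exact_mod_cast h0.ne'
  have hPXP : P (X (P g)) = 0 := congrArg (· g) h.codiagonal_left.1
  rw [hPg] at hPXP
  -- Since X²g = t²g, this vector is the component of 2g in the t-eigenspace. Applying P returns g,
  -- because PXP = 0, so it is nonzero.
  refine Module.End.hasEigenvalue_of_hasEigenvector (x := g + (t : ℂ)⁻¹ • X g)
    ⟨Module.End.mem_eigenspace_iff.2 ?_, ?_⟩
  · change X (g + (t : ℂ)⁻¹ • X g) = _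
    rw [map_add, map_smul, hXX, smul_add, smul_smul, smul_smul, mul_inv_cancel₀ ht0, one_smul,
      add_comm]
    congr 2
    push_cast
    field_simp
  · intro h2
    have := congrArg P h2
    rw [map_add, map_smul, hPg, hPXP, smul_zero, add_zero, map_zero] at this
    exact hg.2 this

theorem hasEigenvalue_corner_of_mem_spectrum (h : IsGeodesicExponent P Q X)
    (hP : IsStarProjection P) (hQ : IsStarProjection Q) (hK : IsCompactOperator (P * Q * P))
    {t : ℝ} (ht : t ∈ spectrum ℝ X) (h0 : t ≠ 0) (h1 : |t| < Real.pi / 2) :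
    Module.End.HasEigenvalue ((P * Q * P : H →L[ℂ] H) : H →ₗ[ℂ] H)
      ((Real.cos t ^ 2 : ℝ) : ℂ) := by
  have hX := h.isSelfAdjoint
  have hcos : 0 < Real.cos t := Real.cos_pos_of_mem_Ioo (abs_lt.1 h1)
  have hc0 : ((Real.cos t ^ 2 : ℝ) : ℂ) ≠ 0 := by
    exact_mod_cast (pow_pos hcos 2).ne'
  have hc1 : ((Real.cos t ^ 2 : ℝ) : ℂ) ≠ 1 := by
    have hs : Real.sin t ≠ 0 := by
      rw [abs_lt] at h1
      rcases lt_or_gt_of_ne h0 with hlt | hgt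
      · exact (Real.sin_neg_of_neg_of_neg_pi_lt hlt (by linarith [Real.pi_pos])).ne
      · exact (Real.sin_pos_of_pos_of_lt_pi hgt (by linarith [Real.pi_pos])).ne'
    have : Real.cos t ^ 2 ≠ 1 := by
      have := Real.sin_sq_add_cos_sq t
      have := pow_pos (abs_pos.2 hs) 2
      rw [sq_abs] at this
      linarith
    exact_mod_cast this
  have h2 : Real.cos t ^ 2 ∈ spectrum ℝ ((P + Q - 1) * (P + Q - 1)) := by
    rw [← h.cfc_cos_sq hP hQ, cfc_map_spectrum (fun t => Real.cos t ^ 2) X]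
    exact ⟨t, ht, rfl⟩
  have hsa : IsSelfAdjoint ((P + Q - 1) * (P + Q - 1)) := by
    rw [← h.cfc_cos_sq hP hQ]; exact cfc_predicate _ _
  have h3 : ((Real.cos t ^ 2 : ℝ) : ℂ) ∈ spectrum ℂ ((P + Q - 1) * (P + Q - 1)) := by
    rw [← hsa.spectrumRestricts.algebraMap_image]
    exact ⟨_, h2, rfl⟩
  exact (hK.hasEigenvalue_iff_mem_spectrum hc0).2 (mem_spectrum_corner_of_mem_spectrum_sq
    hP.isIdempotentElem.eq hQ.isIdempotentElem.eq hc0 hc1 h3)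

end IsGeodesicExponent

/-! ### Eigenvalues of PQP for orthogonal projections P, Q -/

section StarProjections
variable {H : Type*} [NormedAddCommGroup H] [InnerProductSpace ℂ H] [CompleteSpace H]

theorem IsStarProjection.inner_left {P : H →L[ℂ] H} (hP : IsStarProjection P) (x y : H) :
    inner ℂ (P x) y = inner ℂ x (P y) :=
  (ContinuousLinearMap.isSelfAdjoint_iff_isSymmetric.1 hP.isSelfAdjoint) x y

theorem IsStarProjection.apply_apply {P : H →L[ℂ] H} (hP : IsStarProjection P) (x : H) :
    P (P x) = P x := congrArg (· x) hP.isIdempotentElem.eq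

theorem IsStarProjection.norm_apply_le {P : H →L[ℂ] H} (hP : IsStarProjection P) (x : H) :
    ‖P x‖ ≤ ‖x‖ := by
  have h1 : ‖P x‖ ^ 2 ≤ ‖P x‖ * ‖x‖ := by
    have h2 : inner ℂ (P x) (P x) = inner ℂ (P x) x := by
      rw [hP.inner_left x (P x), hP.inner_left x x, hP.apply_apply]
    rw [← @inner_self_eq_norm_sq ℂ, h2]
    exact (RCLike.re_le_norm _).trans (norm_inner_le_norm _ _)
  by_contra hlt
  rw [not_le] at hlt
  nlinarith [norm_nonneg x]

theorem IsStarProjection.inner_corner {P Q : H →L[ℂ] H} (hP : IsStarProjection P)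
    (hQ : IsStarProjection Q) (x : H) :
    inner ℂ x ((P * Q * P) x) = ((‖Q (P x)‖ ^ 2 : ℝ) : ℂ) := by
  change inner ℂ x (P (Q (P x))) = _
  have h1 : inner ℂ (P x) (Q (P x)) = inner ℂ (Q (P x)) (Q (P x)) := by
    rw [hQ.inner_left, hQ.apply_apply]
  rw [← hP.inner_left, h1, inner_self_eq_norm_sq_to_K]
  simp

theorem IsStarProjection.isSymmetric_corner {P Q : H →L[ℂ] H} (hP : IsStarProjection P)
    (hQ : IsStarProjection Q) : ((P * Q * P : H →L[ℂ] H) : H →ₗ[ℂ] H).IsSymmetric := by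
  intro x y
  change inner ℂ (P (Q (P x))) y = inner ℂ x (P (Q (P y)))
  rw [hP.inner_left, hQ.inner_left, hP.inner_left]

/-- An eigenvalue equals the Rayleigh quotient ‖QPv‖²/‖v‖², which lies in [0, 1]; t is the arccosine
of its root. -/
theorem exists_cos_sq_eq_of_hasEigenvalue_corner {P Q : H →L[ℂ] H} (hP : IsStarProjection P)
    (hQ : IsStarProjection Q) {μ : ℂ} (h0 : μ ≠ 0)
    (he : Module.End.HasEigenvalue ((P * Q * P : H →L[ℂ] H) : H →ₗ[ℂ] H) μ) :
    ∃ t : ℝ, 0 ≤ t ∧ t < Real.pi / 2 ∧ μ = ((Real.cos t ^ 2 : ℝ) : ℂ) := by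
  obtain ⟨v, hv⟩ := he.exists_hasEigenvector
  have hv' : (P * Q * P) v = μ • v := hv.apply_eq_smul
  have h1 := hP.inner_corner hQ v
  rw [hv', inner_smul_right, inner_self_eq_norm_sq_to_K] at h1
  have hvn : 0 < ‖v‖ := norm_pos_iff.2 hv.2
  have hvc : ((‖v‖ : ℝ) : ℂ) ≠ 0 := by exact_mod_cast hvn.ne'
  set s := ‖Q (P v)‖ / ‖v‖ with hs
  have hμ : μ = ((s ^ 2 : ℝ) : ℂ) := by
    rw [hs]
    push_cast
    push_cast at h1
    rw [div_pow, eq_div_iff (pow_ne_zero 2 hvc)]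
    exact h1
  have hs0 : 0 < s := lt_of_le_of_ne (by positivity) fun h => h0 (by rw [hμ, ← h]; simp)
  have hs1 : s ≤ 1 := by
    rw [hs, div_le_one hvn]
    exact (hQ.norm_apply_le _).trans (hP.norm_apply_le _)
  refine ⟨Real.arccos s, Real.arccos_nonneg _, Real.arccos_lt_pi_div_two.2 hs0, ?_⟩
  rw [Real.cos_arccos (by linarith) hs1, hμ]

theorem finite_setOf_cos_sq_hasEigenvalue {P Q : H →L[ℂ] H} (hP : IsStarProjection P)
    (hQ : IsStarProjection Q) (hK : IsCompactOperator (P * Q * P)) {r : ℝ} (hr : r < Real.pi / 2) :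
    ({t : ℝ | 0 < t ∧ t < Real.pi / 2 ∧ Module.End.HasEigenvalue
      ((P * Q * P : H →L[ℂ] H) : H →ₗ[ℂ] H) ((Real.cos t ^ 2 : ℝ) : ℂ)} ∩ Set.Iic r).Finite := by
  rcases le_or_gt r 0 with h0 | h0
  · refine Set.finite_empty.subset ?_
    rintro t ⟨⟨ht, -⟩, hle⟩
    exact absurd (lt_of_lt_of_le ht hle) (not_lt.2 h0)
  have hcr : 0 < Real.cos r := Real.cos_pos_of_mem_Ioo ⟨by linarith, hr⟩
  have hfin := finite_setOf_hasEigenvalue_of_isCompactOperator hK (hP.isSymmetric_corner hQ)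
    (pow_pos hcr 2)
  refine Set.Finite.of_finite_image (f := fun t : ℝ => ((Real.cos t ^ 2 : ℝ) : ℂ))
    (hfin.subset ?_) ?_
  · rintro _ ⟨t, ⟨⟨ht0, ht1, ht⟩, htr⟩, rfl⟩
    refine ⟨?_, ht⟩
    rw [Complex.norm_real, Real.norm_of_nonneg (by positivity)]
    have := Real.cos_le_cos_of_nonneg_of_le_pi ht0.le (by linarith) (Set.mem_Iic.1 htr)
    gcongr
  · rintro s ⟨⟨hs0, hs1, -⟩, -⟩ t ⟨⟨ht0, ht1, -⟩, -⟩ hst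
    have h1 : Real.cos s ^ 2 = Real.cos t ^ 2 := Complex.ofReal_injective hst
    have h2 : Real.cos s = Real.cos t := (pow_left_inj₀
      (Real.cos_nonneg_of_neg_pi_div_two_le_of_le (by linarith) hs1.le)
      (Real.cos_nonneg_of_neg_pi_div_two_le_of_le (by linarith) ht1.le) two_ne_zero).1 h1
    exact Real.injOn_cos ⟨hs0.le, by linarith⟩ ⟨ht0.le, by linarith⟩ h2

theorem infinite_setOf_cos_sq_hasEigenvalue {P Q : H →L[ℂ] H} (hP : IsStarProjection P)
    (hQ : IsStarProjection Q) (hK : IsCompactOperator (P * Q * P))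
    (hr : ¬ FiniteDimensional ℂ (P * Q * P).range) :
    {t : ℝ | 0 < t ∧ t < Real.pi / 2 ∧ Module.End.HasEigenvalue
      ((P * Q * P : H →L[ℂ] H) : H →ₗ[ℂ] H) ((Real.cos t ^ 2 : ℝ) : ℂ)}.Infinite := by
  intro hfin
  refine infinite_setOf_hasEigenvalue_of_isCompactOperator hK (hP.isSymmetric_corner hQ) hr
    -- The eigenvalue 1 corresponds to t = 0, which the open interval omits.
    (((hfin.image fun t : ℝ => ((Real.cos t ^ 2 : ℝ) : ℂ)).insert 1).subset ?_)
  rintro μ ⟨h0, he⟩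
  obtain ⟨t, ht0, ht1, rfl⟩ := exists_cos_sq_eq_of_hasEigenvalue_corner hP hQ h0 he
  rcases ht0.eq_or_lt with rfl | ht0
  · left; simp
  · right; exact ⟨t, ⟨ht0, ht1, he⟩, rfl⟩

/-- If v = Pv + Qv, then applying P and Q gives PQv = 0 = QPv, so Pv and Qv lie in the two trivial
intersections. -/
theorem injective_add_sub_one_of_rangesMeetKernelsTrivially {P Q : H →L[ℂ] H} (hP : IsStarProjection P)
    (hQ : IsStarProjection Q) (hR : RangesMeetKernelsTrivially P Q) :
    Function.Injective (P + Q - 1 : H →L[ℂ] H) := by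
  refine (injective_iff_map_eq_zero _).2 fun v h2 => ?_
  have h3 : P v + Q v = v := by
    have : P v + Q v - v = 0 := h2
    exact sub_eq_zero.1 this
  have h4 : P (Q v) = 0 := by
    have := congrArg P h3
    rw [map_add, hP.apply_apply] at this
    simpa using this
  have h5 : Q (P v) = 0 := by
    have := congrArg Q h3
    rw [map_add, hQ.apply_apply] at this
    simpa using this
  have h6 : P v = 0 := by
    have : P v ∈ P.range ⊓ Q.ker := ⟨⟨v, rfl⟩, h5⟩
    rwa [hR.1, Submodule.mem_bot] at this
  have h7 : Q v = 0 := by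
    have : Q v ∈ P.ker ⊓ Q.range := ⟨h4, ⟨v, rfl⟩⟩
    rwa [hR.2, Submodule.mem_bot] at this
  rw [← h3, h6, h7, add_zero]

end StarProjections

/-! ### Multiplicities, closed range, kernel and commutators -/

namespace IsGeodesicExponent
variable {H : Type*} [NormedAddCommGroup H] [InnerProductSpace ℂ H] [CompleteSpace H]
  {P Q X : H →L[ℂ] H}

theorem map_reflection (h : IsGeodesicExponent P Q X) (hP : IsStarProjection P) (v : H) :
    X ((2 * P - 1) v) = -((2 * P - 1) (X v)) := by
  have h1 : X * (2 * P - 1) = -((2 * P - 1) * X) := by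
    have := (isCodiagonal_iff hP.isIdempotentElem.eq).1 h.codiagonal_left
    have h2 := congrArg ((2 * P - 1) * ·) this
    simp only [← mul_assoc, reflection_mul_self hP.isIdempotentElem.eq, one_mul, mul_neg] at h2
    exact h2
  exact congrArg (· v) h1

theorem map_reflection_eigSpace_le (h : IsGeodesicExponent P Q X) (hP : IsStarProjection P)
    (z : ℂ) : (eigSpace X z).map ((2 * P - 1 : H →L[ℂ] H) : H →ₗ[ℂ] H) ≤ eigSpace X (-z) := by
  rintro _ ⟨v, hv, rfl⟩
  have hv' : X v = z • v := Module.End.mem_eigenspace_iff.1 hv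
  refine Module.End.mem_eigenspace_iff.2 ?_
  change X ((2 * P - 1) v) = -z • (2 * P - 1) v
  rw [h.map_reflection hP, hv', map_smul, neg_smul]

/-- The reflection `2P - 1` exchanges the eigenspaces of `z` and `-z`. -/
noncomputable def eigSpaceEquivNeg (h : IsGeodesicExponent P Q X) (hP : IsStarProjection P)
    (z : ℂ) : eigSpace X z ≃ₗ[ℂ] eigSpace X (-z) :=
  have hmap : ∀ (w : ℂ) (v : H), v ∈ eigSpace X w → (2 * P - 1) v ∈ eigSpace X (-w) :=
    fun w v hv => h.map_reflection_eigSpace_le hP w ⟨v, hv, rfl⟩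
  have hinv : ∀ v : H, (2 * P - 1) ((2 * P - 1) v) = v := fun v =>
    congrArg (· v) (reflection_mul_self hP.isIdempotentElem.eq)
  LinearEquiv.ofLinearMap
    (((2 * P - 1 : H →L[ℂ] H) : H →ₗ[ℂ] H).restrict (hmap z))
    (((2 * P - 1 : H →L[ℂ] H) : H →ₗ[ℂ] H).restrict
      fun v hv => (neg_neg z) ▸ hmap (-z) v hv)
    (by ext v; exact hinv v) (by ext v; exact hinv v)

theorem finiteDimensional_eigSpace (h : IsGeodesicExponent P Q X) (hP : IsStarProjection P)
    (hQ : IsStarProjection Q) (hK : IsCompactOperator (P * Q * P)) {t : ℝ} (h0 : 0 < t)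
    (h1 : t < Real.pi / 2) : FiniteDimensional ℂ (eigSpace X (t : ℂ)) := by
  have hcos : 0 < Real.cos t := Real.cos_pos_of_mem_Ioo ⟨by linarith, h1⟩
  have hc0 : ((Real.cos t ^ 2 : ℝ) : ℂ) ≠ 0 := by
    exact_mod_cast (pow_pos hcos 2).ne'
  have := ContinuousLinearMap.finite_dimensional_eigenspace hK _ hc0
  let f : eigSpace X (t : ℂ) →ₗ[ℂ] Module.End.eigenspace (P * Q * P).toLinearMap
      ((Real.cos t ^ 2 : ℝ) : ℂ) :=
    (P : H →ₗ[ℂ] H).restrict fun v hv => Module.End.mem_eigenspace_iff.2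
      (h.corner_apply hP hQ (Module.End.mem_eigenspace_iff.1 hv))
  refine FiniteDimensional.of_injective f ((injective_iff_map_eq_zero f).2 fun v hv => ?_)
  by_contra hv0
  exact h.apply_ne_zero h0.ne' (Module.End.mem_eigenspace_iff.1 v.2)
    (fun h => hv0 (Subtype.ext h)) (congrArg Subtype.val hv)

theorem eigSpace_eq_bot_of_cos_eq_zero (h : IsGeodesicExponent P Q X) (hP : IsStarProjection P)
    (hQ : IsStarProjection Q) (hR : RangesMeetKernelsTrivially P Q) {t : ℝ}
    (ht : Real.cos t = 0) : eigSpace X (t : ℂ) = ⊥ := by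
  rw [Submodule.eq_bot_iff]
  intro v hv
  have h1 := h.sq_apply hP hQ (Module.End.mem_eigenspace_iff.1 hv)
  rw [ht] at h1
  have hPs := ContinuousLinearMap.isSelfAdjoint_iff_isSymmetric.1
    ((hP.isSelfAdjoint.add hQ.isSelfAdjoint).sub (IsSelfAdjoint.one (H →L[ℂ] H)))
  have h2 : (P + Q - 1) v = 0 := by
    rw [← @inner_self_eq_zero ℂ]
    refine (hPs v _).trans ?_
    change inner ℂ v ((P + Q - 1) ((P + Q - 1) v)) = 0
    rw [h1]
    simp
  exact injective_add_sub_one_of_rangesMeetKernelsTrivially hP hQ hR (h2.trans (map_zero _).symm)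

/-- Spectral points of X in (0, π/4], up to sign, come from finitely many eigenvalues of PQP, so 0
is not an accumulation point of σ(X). Inversion is then continuous on σ(X) and yields a generalized
inverse. -/
theorem exists_mul_mul_eq (h : IsGeodesicExponent P Q X) (hP : IsStarProjection P)
    (hQ : IsStarProjection Q) (hK : IsCompactOperator (P * Q * P)) :
    ∃ Y : H →L[ℂ] H, X * Y * X = X := by
  have hX := h.isSelfAdjoint
  have hfin := finite_setOf_cos_sq_hasEigenvalue hP hQ hK
    (by linarith [Real.pi_pos] : Real.pi / 4 < Real.pi / 2)
  have hev : ∀ᶠ r : ℝ in 𝓝 0, r ∉ ({t : ℝ | 0 < t ∧ t < Real.pi / 2 ∧ Module.End.HasEigenvalue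
      ((P * Q * P : H →L[ℂ] H) : H →ₗ[ℂ] H) ((Real.cos t ^ 2 : ℝ) : ℂ)} ∩
      Set.Iic (Real.pi / 4)) :=
    hfin.isClosed.isOpen_compl.mem_nhds fun h => lt_irrefl _ h.1.1
  obtain ⟨δ, hδ, hball⟩ := Metric.eventually_nhds_iff.1 hev
  have hiso : ∀ t ∈ spectrum ℝ X, |t| < min δ (Real.pi / 4) → t = 0 := by
    intro t ht htδ
    by_contra h0
    have hp := Real.pi_pos
    have h1 := hasEigenvalue_corner_of_mem_spectrum h hP hQ hK ht h0
      (by linarith [min_le_right δ (Real.pi / 4)])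
    refine @hball |t| ?_ ⟨⟨abs_pos.2 h0, by linarith [min_le_right δ (Real.pi / 4)], ?_⟩, ?_⟩
    · rw [Real.dist_eq, sub_zero, abs_abs]
      exact htδ.trans_le (min_le_left _ _)
    · rwa [Real.cos_abs]
    · exact (htδ.trans_le (min_le_right _ _)).le
  have hcont : ContinuousOn (fun t : ℝ => t⁻¹) (spectrum ℝ X) := by
    intro t ht
    by_cases h0 : t = 0
    · subst h0
      -- The convention 0⁻¹ = 0 supplies the value on the kernel.
      refine (continuousWithinAt_const (b := (0 : ℝ))).congr_of_eventuallyEq ?_ inv_zero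
      have : Metric.ball (0 : ℝ) (min δ (Real.pi / 4)) ∈ 𝓝 (0 : ℝ) :=
        Metric.ball_mem_nhds _ (by have := Real.pi_pos; positivity)
      filter_upwards [self_mem_nhdsWithin, mem_nhdsWithin_of_mem_nhds this] with s hs hs'
      rw [hiso s hs (by simpa using hs'), inv_zero]
    · exact (continuousAt_inv₀ h0).continuousWithinAt
  refine ⟨cfc (fun t : ℝ => t⁻¹) X, ?_⟩
  have hid := cfc_id' ℝ X
  calc X * cfc (fun t : ℝ => t⁻¹) X * X
      = cfc (fun t : ℝ => t) X * cfc (fun t : ℝ => t⁻¹) X * cfc (fun t : ℝ => t) X := by rw [hid]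
    _ = cfc (fun t : ℝ => t * t⁻¹ * t) X := by
        rw [cfc_mul (fun t : ℝ => t * t⁻¹) (fun t => t) X (continuousOn_id.mul hcont)
          continuousOn_id, cfc_mul (fun t : ℝ => t) (fun t => t⁻¹) X continuousOn_id hcont]
    _ = cfc (fun t : ℝ => t) X := cfc_congr fun t _ => mul_inv_mul_cancel t
    _ = X := hid

theorem isClosed_range (h : IsGeodesicExponent P Q X) (hP : IsStarProjection P)
    (hQ : IsStarProjection Q) (hK : IsCompactOperator (P * Q * P)) :
    IsClosed (X.range : Set H) := by
  obtain ⟨Y, hY⟩ := h.exists_mul_mul_eq hP hQ hK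
  have : (X.range : Set H) = {y | X (Y y) = y} := by
    ext y
    constructor
    · rintro ⟨x, rfl⟩
      exact congrArg (· x) hY
    · intro hy
      exact ⟨Y y, hy⟩
  rw [this]
  exact isClosed_eq (by fun_prop) continuous_id

/-- With C = cos² X, X C(1-P) = PQP X is compact. If N(X) had finite dimension, X would be left
invertible modulo compacts, so C(1-P) would be compact. But RC(1-P)R = R - RQR with QR compact, so R
would be compact, contrary to its infinite rank. -/
theorem not_finiteDimensional_eigSpace_zero (h : IsGeodesicExponent P Q X)
    (hP : IsStarProjection P) (hQ : IsStarProjection Q) (hK : IsCompactOperator (P * Q * P))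
    {R : H →L[ℂ] H} (hR : IsStarProjection R) (hRinf : ¬ FiniteDimensional ℂ R.range)
    (hPR : P * R = 0) (hRP : R * P = 0) (hQR : IsCompactOperator (Q * R)) :
    ¬ FiniteDimensional ℂ (eigSpace X 0) := by
  intro hfd
  obtain ⟨Y, hY⟩ := h.exists_mul_mul_eq hP hQ hK
  set C := (P + Q - 1) * (P + Q - 1) with hC
  have hXC : X * C = C * X := by
    rw [hC, ← h.cfc_cos_sq hP hQ]
    have := cfc_commute_cfc (fun t : ℝ => t) (fun t => Real.cos t ^ 2) X
    rwa [cfc_id' ℝ X h.isSelfAdjoint] at this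
  have hX1 : X * (1 - P) = P * X := by
    rw [mul_sub, mul_one, sub_eq_iff_eq_add]
    exact h.eq_mul_add_mul
  have c1 : IsCompactOperator (X * (C * (1 - P)) : H →L[ℂ] H) := by
    have : X * (C * (1 - P)) = P * Q * P * X := by
      rw [← mul_assoc, hXC, mul_assoc, hX1, ← mul_assoc, hC,
        sq_add_sub_one_mul hP.isIdempotentElem.eq hQ.isIdempotentElem.eq]
    rw [this]
    exact hK.mul_clm X
  have c2 : IsCompactOperator (1 - Y * X : H →L[ℂ] H) := by
    have hle : (1 - Y * X : H →L[ℂ] H).range ≤ eigSpace X 0 := by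
      rintro _ ⟨x, rfl⟩
      refine Module.End.mem_eigenspace_iff.2 ?_
      have : X * (1 - Y * X) = 0 := by rw [mul_sub, mul_one, ← mul_assoc, hY, sub_self]
      rw [zero_smul]
      exact congrArg (· x) this
    have := Submodule.finiteDimensional_of_le hle
    exact isCompactOperator_of_finiteDimensional_range _
  have c3 : IsCompactOperator (C * (1 - P) : H →L[ℂ] H) := by
    have : C * (1 - P) = Y * (X * (C * (1 - P))) + (1 - Y * X) * (C * (1 - P)) := by
      noncomm_ring
    rw [this]
    exact (c1.clm_mul Y).add (c2.mul_clm _)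
  have c4 : IsCompactOperator R := by
    have h1 : R * (C * (1 - P)) * R + R * (Q * R) = R := by
      have e1 : R * (C * (1 - P)) * R =
        R * (P * P) * R + R * P * Q * R + R * Q * (P * R) + R * (Q * Q) * R - 2 * (R * P * R)
          - 2 * (R * Q * R) + R * R - R * C * (P * R) := by
        rw [hC]; noncomm_ring
      rw [e1, hP.isIdempotentElem.eq, hQ.isIdempotentElem.eq, hRP, hPR, hR.isIdempotentElem.eq]
      noncomm_ring
    rw [← h1]
    exact ((c3.clm_mul R).mul_clm R).add (hQR.clm_mul R)
  exact hRinf (c4.finiteDimensional_range_of_isIdempotentElem hR.isIdempotentElem.eq)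

/-- sin t / t has no zero on [-π/2, π/2], so its reciprocal, applied to X, is a bounded operator. -/
theorem exists_eq_mul_cfc_sin (h : IsGeodesicExponent P Q X) :
    ∃ W : H →L[ℂ] H, X = W * cfc Real.sin X ∧ X = cfc Real.sin X * W := by
  have hX := h.isSelfAdjoint
  have hsin : ∀ t ∈ spectrum ℝ X, t ≠ 0 → Real.sin t ≠ 0 := by
    intro t ht h0
    have h1 := abs_le.1 (h.abs_le_of_mem_spectrum ht)
    rcases lt_or_gt_of_ne h0 with hlt | hgt
    · exact (Real.sin_neg_of_neg_of_neg_pi_lt hlt (by linarith [Real.pi_pos])).ne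
    · exact (Real.sin_pos_of_pos_of_lt_pi hgt (by linarith [Real.pi_pos])).ne'
  have hsinc : ∀ t ∈ spectrum ℝ X, Real.sinc t ≠ 0 := by
    intro t ht
    rcases eq_or_ne t 0 with rfl | h0
    · simp
    · rw [Real.sinc_of_ne_zero h0]
      exact div_ne_zero (hsin t ht h0) h0
  have hcont : ContinuousOn (fun t => (Real.sinc t)⁻¹) (spectrum ℝ X) :=
    Real.continuous_sinc.continuousOn.inv₀ hsinc
  have hval : ∀ t ∈ spectrum ℝ X, (Real.sinc t)⁻¹ * Real.sin t = t := by
    intro t ht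
    rcases eq_or_ne t 0 with rfl | h0
    · simp
    · have := hsin t ht h0
      rw [Real.sinc_of_ne_zero h0]
      field_simp
  have key : X = cfc (fun t => (Real.sinc t)⁻¹) X * cfc Real.sin X := by
    rw [← cfc_mul (fun t => (Real.sinc t)⁻¹) Real.sin X hcont Real.continuous_sin.continuousOn,
      cfc_congr (g := fun t => t) hval, cfc_id' ℝ X]
  exact ⟨_, key, key.trans (cfc_commute_cfc _ _ X)⟩

/-- 2i sin X = U⁻¹(U² - 1) = (U² - 1)U⁻¹ with U² - 1 = 4QP - 2Q - 2P. Multiplied by R on either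
side, the terms with PR or RP vanish and the others contain QR or RQ. Thus XR and RX are each
compact. -/
theorem isCompactOperator_commutator (h : IsGeodesicExponent P Q X)
    (hP : IsStarProjection P) {R : H →L[ℂ] H}
    (hPR : P * R = 0) (hRP : R * P = 0) (hQR : IsCompactOperator (Q * R))
    (hRQ : IsCompactOperator (R * Q)) :
    IsCompactOperator (X * R - R * X) := by
  have hX := h.isSelfAdjoint
  set U := NormedSpace.exp (Complex.I • X) with hU
  set V := NormedSpace.exp (-(Complex.I • X)) with hV
  have hUV : U * V = 1 := exp_mul_exp_neg' _
  have hVU : V * U = 1 := exp_neg_mul_exp' _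
  set Z := cfc Real.sin X with hZ
  have hsin : U - V = (2 * Complex.I) • Z := by
    rw [hU, hV, exp_I_smul_eq hX, exp_neg_I_smul_eq hX, mul_smul, two_smul]
    abel
  have h2I : (2 * Complex.I) ≠ 0 := by simp
  have hZ1 : Z = (2 * Complex.I)⁻¹ • (V * (U * U - 1)) := by
    rw [eq_inv_smul_iff₀ h2I, ← hsin, mul_sub, ← mul_assoc, hVU, one_mul, mul_one]
  have hZ2 : Z = (2 * Complex.I)⁻¹ • ((U * U - 1) * V) := by
    rw [eq_inv_smul_iff₀ h2I, ← hsin, sub_mul, mul_assoc, hUV, one_mul, mul_one]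
  have hUU : U * U - 1 = 4 * (Q * P) - 2 * Q - 2 * P := by
    rw [h.exp_mul_exp hP.isIdempotentElem.eq]
    noncomm_ring
  have two_compact : ∀ {A : H →L[ℂ] H}, IsCompactOperator A → IsCompactOperator (2 * A : H →L[ℂ] H) :=
    fun hA => hA.clm_mul 2
  have four_compact : ∀ {A : H →L[ℂ] H}, IsCompactOperator A → IsCompactOperator (4 * A : H →L[ℂ] H) :=
    fun hA => hA.clm_mul 4
  have smul_compact : ∀ {A : H →L[ℂ] H}, IsCompactOperator A →
      IsCompactOperator ((2 * Complex.I)⁻¹ • A) := fun hA => hA.smul _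
  have cZR : IsCompactOperator (Z * R) := by
    have : Z * R = (2 * Complex.I)⁻¹ • (V * -(2 * (Q * R))) := by
      rw [hZ1, hUU, smul_mul_assoc, mul_assoc]
      congr 2
      have : (4 * (Q * P) - 2 * Q - 2 * P) * R = 4 * (Q * (P * R)) - 2 * (Q * R) - 2 * (P * R) := by
        noncomm_ring
      rw [this, hPR]
      simp
    rw [this]
    exact smul_compact ((two_compact hQR).neg.clm_mul V)
  have cRZ : IsCompactOperator (R * Z) := by
    have : R * Z = (2 * Complex.I)⁻¹ • ((4 * (R * Q * P) - 2 * (R * Q)) * V) := by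
      rw [hZ2, hUU, mul_smul_comm, ← mul_assoc]
      congr 2
      have : R * (4 * (Q * P) - 2 * Q - 2 * P) = 4 * (R * Q * P) - 2 * (R * Q) - 2 * (R * P) := by
        noncomm_ring
      rw [this, hRP]
      simp
    rw [this]
    exact smul_compact (((four_compact (hRQ.mul_clm P)).sub (two_compact hRQ)).mul_clm V)
  obtain ⟨W, hXW, hXW'⟩ := h.exists_eq_mul_cfc_sin
  have e1 : X * R = W * (Z * R) := by rw [← mul_assoc, ← hXW]
  have e2 : R * X = R * Z * W := by rw [mul_assoc, ← hXW']
  rw [e1, e2]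
  exact (cZR.clm_mul W).sub (cRZ.mul_clm W)

end IsGeodesicExponent

/-! ### Assembly of the spectrum; infinite rank and noncompactness -/

namespace IsGeodesicExponent
variable {H : Type*} [NormedAddCommGroup H] [InnerProductSpace ℂ H] [CompleteSpace H]
  {P Q X : H →L[ℂ] H}

theorem eigSpace_neg_eq_bot_iff (h : IsGeodesicExponent P Q X) (hP : IsStarProjection P)
    (z : ℂ) : eigSpace X (-z) = ⊥ ↔ eigSpace X z = ⊥ := by
  rw [← Submodule.subsingleton_iff_eq_bot, ← Submodule.subsingleton_iff_eq_bot]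
  exact (h.eigSpaceEquivNeg hP z).toEquiv.subsingleton_congr.symm

theorem mem_spectrum_of_eigSpace_ne_bot {z : ℂ} (hz : eigSpace X z ≠ ⊥) : z ∈ spectrum ℂ X := by
  rw [ContinuousLinearMap.spectrum_eq]
  exact Module.End.HasEigenvalue.mem_spectrum (Module.End.hasEigenvalue_iff.2 hz)

theorem exists_spectrum_eq (h : IsGeodesicExponent P Q X) (hP : IsStarProjection P)
    (hQ : IsStarProjection Q) (hK : IsCompactOperator (P * Q * P))
    (hr : ¬ FiniteDimensional ℂ (P * Q * P).range) (hker : eigSpace X 0 ≠ ⊥) :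
    ∃ γ : ℕ → ℝ, StrictMono γ ∧ (∀ k, 0 < γ k ∧ γ k < Real.pi / 2) ∧
      Tendsto γ atTop (𝓝 (Real.pi / 2)) ∧
      spectrum ℂ X = {0} ∪ Set.range (fun k => (γ k : ℂ)) ∪ Set.range (fun k => -(γ k : ℂ)) ∪
        {((Real.pi / 2 : ℝ) : ℂ), -((Real.pi / 2 : ℝ) : ℂ)} ∧
      ∀ k, eigSpace X (γ k) ≠ ⊥ := by
  obtain ⟨γ, hmono, hrange, hlim⟩ := exists_strictMono_range_eq
    (infinite_setOf_cos_sq_hasEigenvalue hP hQ hK hr) (fun x hx => hx.2.1)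
    (fun r hr => finite_setOf_cos_sq_hasEigenvalue hP hQ hK hr)
  have hγ : ∀ k, 0 < γ k ∧ γ k < Real.pi / 2 ∧ Module.End.HasEigenvalue
      ((P * Q * P : H →L[ℂ] H) : H →ₗ[ℂ] H) ((Real.cos (γ k) ^ 2 : ℝ) : ℂ) :=
    fun k => hrange.subset ⟨k, rfl⟩
  have hne : ∀ k, eigSpace X (γ k) ≠ ⊥ := fun k =>
    (h.hasEigenvalue_of_hasEigenvalue_corner hP hQ (hγ k).1 (hγ k).2.1 (hγ k).2.2)
  have hpos : ∀ k, (γ k : ℂ) ∈ spectrum ℂ X := fun k => mem_spectrum_of_eigSpace_ne_bot (hne k)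
  have hneg : ∀ k, -(γ k : ℂ) ∈ spectrum ℂ X := fun k =>
    mem_spectrum_of_eigSpace_ne_bot ((h.eigSpace_neg_eq_bot_iff hP _).not.2 (hne k))
  have hlimC : Tendsto (fun k => (γ k : ℂ)) atTop (𝓝 ((Real.pi / 2 : ℝ) : ℂ)) :=
    (Complex.continuous_ofReal.tendsto _).comp hlim
  refine ⟨γ, hmono, fun k => ⟨(hγ k).1, (hγ k).2.1⟩, hlim, ?_, hne⟩
  apply subset_antisymm
  · intro z hz
    rw [← h.isSelfAdjoint.spectrumRestricts.algebraMap_image] at hz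
    obtain ⟨t, ht, rfl⟩ := hz
    rcases eq_or_ne t 0 with rfl | h0
    · left; left; left; simp
    rcases (h.abs_le_of_mem_spectrum ht).eq_or_lt with h1 | h1
    · right
      rcases eq_or_eq_neg_of_abs_eq h1 with rfl | rfl
      · left; rfl
      · right; simp
    · left
      have h2 := h.hasEigenvalue_corner_of_mem_spectrum hP hQ hK ht h0 h1
      have h3 : |t| ∈ Set.range γ := by
        rw [hrange]
        exact ⟨abs_pos.2 h0, h1, by rwa [Real.cos_abs]⟩
      obtain ⟨k, hk⟩ := h3
      rcases eq_or_eq_neg_of_abs_eq hk.symm with rfl | rfl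
      · left; right; exact ⟨k, rfl⟩
      · right; exact ⟨k, by simp⟩
  · rintro z (((rfl | ⟨k, rfl⟩) | ⟨k, rfl⟩) | (rfl | rfl))
    · exact mem_spectrum_of_eigSpace_ne_bot hker
    · exact hpos k
    · exact hneg k
    -- ±π/2 enter as limits of eigenvalues; they need not be eigenvalues.
    · exact (spectrum.isClosed X).mem_of_tendsto hlimC (Eventually.of_forall hpos)
    · exact (spectrum.isClosed X).mem_of_tendsto hlimC.neg (Eventually.of_forall hneg)

theorem not_finiteDimensional_range {γ : ℕ → ℝ} (hγ : Function.Injective γ) (h0 : ∀ k, γ k ≠ 0)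
    (he : ∀ k, eigSpace X (γ k) ≠ ⊥) : ¬ FiniteDimensional ℂ X.range := by
  intro hfd
  have hv : ∀ k, ∃ v : H, X v = (γ k : ℂ) • v ∧ v ≠ 0 := fun k => by
    obtain ⟨v, hv, hv0⟩ := Submodule.exists_mem_ne_zero_of_ne_bot (he k)
    exact ⟨v, Module.End.mem_eigenspace_iff.1 hv, hv0⟩
  choose v hv hv0 using hv
  have hli : LinearIndependent ℂ v :=
    Module.End.eigenvectors_linearIndependent' (X : H →ₗ[ℂ] H) (fun k => (γ k : ℂ))
      (Complex.ofReal_injective.comp hγ) v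
      fun k => ⟨Module.End.mem_eigenspace_iff.2 (hv k), hv0 k⟩
  have hmem : ∀ k, v k ∈ X.range := fun k => ⟨(γ k : ℂ)⁻¹ • v k, by
    change X ((γ k : ℂ)⁻¹ • v k) = v k
    rw [map_smul, hv, smul_smul, inv_mul_cancel₀ (by exact_mod_cast h0 k), one_smul]⟩
  have hli' : LinearIndependent ℂ (fun k => (⟨v k, hmem k⟩ : X.range)) :=
    LinearIndependent.of_comp X.range.subtype hli
  have := hli'.finite
  exact not_finite ℕ

/-- If X were compact, so would be the idempotent XY onto its range, and a compact idempotent has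
finite rank. -/
theorem not_isCompactOperator (h : IsGeodesicExponent P Q X) (hP : IsStarProjection P)
    (hQ : IsStarProjection Q) (hK : IsCompactOperator (P * Q * P))
    (hr : ¬ FiniteDimensional ℂ X.range) : ¬ IsCompactOperator X := by
  intro hX
  obtain ⟨Y, hY⟩ := h.exists_mul_mul_eq hP hQ hK
  have hidem : X * Y * (X * Y) = X * Y := by rw [← mul_assoc, hY]
  have := (hX.mul_clm Y).finiteDimensional_range_of_isIdempotentElem hidem
  have hle : X.range ≤ (X * Y : H →L[ℂ] H).range := by
    rintro _ ⟨x, rfl⟩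
    exact ⟨X x, congrArg (· x) hY⟩
  exact hr (Submodule.finiteDimensional_of_le hle)

end IsGeodesicExponent

/-! ### Uniqueness -/

section Uniqueness
variable {H : Type*} [NormedAddCommGroup H] [InnerProductSpace ℂ H]

theorem mul_left_cancel_of_injective {C A B : H →L[ℂ] H} (hC : Function.Injective C)
    (h : C * A = C * B) : A = B := by
  ext x
  exact hC (congrArg (· x) h)

variable [CompleteSpace H]

theorem eq_of_exp_I_smul_eq {X Y : H →L[ℂ] H} (hX : IsSelfAdjoint X) (hY : IsSelfAdjoint Y)
    (hX1 : ‖X‖ < Real.pi) (hY1 : ‖Y‖ < Real.pi)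
    (he : NormedSpace.exp (Complex.I • X) = NormedSpace.exp (Complex.I • Y)) : X = Y := by
  have h1 := argSelfAdjoint_expUnitary (x := ⟨X, hX⟩) hX1
  have h2 := argSelfAdjoint_expUnitary (x := ⟨Y, hY⟩) hY1
  have h3 : selfAdjoint.expUnitary ⟨X, hX⟩ = selfAdjoint.expUnitary ⟨Y, hY⟩ := Subtype.ext he
  rw [← h3, h1] at h2
  exact congrArg Subtype.val h2

theorem mul_right_cancel_of_injective {C A B : H →L[ℂ] H} (hs : IsSelfAdjoint C)
    (hC : Function.Injective C) (h : A * C = B * C) : A = B := by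
  have h1 := congrArg star h
  rw [star_mul, star_mul, hs.star_eq] at h1
  exact star_injective (mul_left_cancel_of_injective hC h1)

/-- Cosine is nonnegative on σ(X), so cos X is the positive square root, and it depends only on P
and Q. -/
theorem IsGeodesicExponent.cfc_cos_eq_abs {P Q X : H →L[ℂ] H} (h : IsGeodesicExponent P Q X)
    (hP : IsStarProjection P) (hQ : IsStarProjection Q) :
    cfc Real.cos X = CFC.sqrt ((P + Q - 1) * (P + Q - 1)) := by
  refine (CFC.sqrt_unique (h.cfc_cos_mul_cfc_cos hP hQ) (cfc_nonneg fun t ht => ?_)).symm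
  have := abs_le.1 (h.abs_le_of_mem_spectrum ht)
  exact Real.cos_nonneg_of_neg_pi_div_two_le_of_le (by linarith) this.2

/-- 2e^{iZ} cos Z = e^{2iZ} + 1 = TS + 1 for every exponent Z. The common injective factor cos Z
cancels, and the exponential is injective on selfadjoint operators of norm below π. -/
theorem IsGeodesicExponent.unique {P Q X Y : H →L[ℂ] H} (hP : IsStarProjection P)
    (hQ : IsStarProjection Q) (hR : RangesMeetKernelsTrivially P Q)
    (hX : IsGeodesicExponent P Q X) (hY : IsGeodesicExponent P Q Y) : X = Y := by
  have hpi : Real.pi / 2 < Real.pi := by linarith [Real.pi_pos]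
  refine eq_of_exp_I_smul_eq hX.isSelfAdjoint hY.isSelfAdjoint (hX.norm_eq.trans_lt hpi)
    (hY.norm_eq.trans_lt hpi) ?_
  have key : ∀ {Z : H →L[ℂ] H}, IsGeodesicExponent P Q Z →
      NormedSpace.exp (Complex.I • Z) * cfc Real.cos X =
        (2⁻¹ : ℂ) • ((2 * Q - 1) * (2 * P - 1) + 1) := by
    intro Z hZ
    rw [hX.cfc_cos_eq_abs hP hQ, ← hZ.cfc_cos_eq_abs hP hQ, ← hZ.exp_mul_exp hP.isIdempotentElem.eq,
      eq_inv_smul_iff₀ two_ne_zero, ← mul_smul_comm]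
    have : (2 : ℂ) • cfc Real.cos Z =
        NormedSpace.exp (Complex.I • Z) + NormedSpace.exp (-(Complex.I • Z)) := by
      rw [exp_I_smul_eq hZ.isSelfAdjoint, exp_neg_I_smul_eq hZ.isSelfAdjoint, two_smul]
      abel
    rw [this, mul_add, exp_mul_exp_neg']
  refine mul_right_cancel_of_injective (cfc_predicate Real.cos X) ?_ ((key hX).trans (key hY).symm)
  refine (injective_iff_map_eq_zero _).2 fun v hv => ?_
  have h1 : ((P + Q - 1) * (P + Q - 1)) v = 0 := by
    rw [← hX.cfc_cos_mul_cfc_cos hP hQ]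
    change cfc Real.cos X (cfc Real.cos X v) = 0
    rw [hv, map_zero]
  have hinj := injective_add_sub_one_of_rangesMeetKernelsTrivially hP hQ hR
  exact (hinj.comp hinj) (h1.trans (map_zero ((P + Q - 1) * (P + Q - 1))).symm)

end Uniqueness

/-! ### Existence by polar decomposition -/

section Existence
variable {H : Type*} [NormedAddCommGroup H] [InnerProductSpace ℂ H] [CompleteSpace H]

theorem denseRange_of_isSelfAdjoint_of_injective {C : H →L[ℂ] H} (hs : IsSelfAdjoint C)
    (hC : Function.Injective C) : DenseRange C := by
  have h1 : C.rangeᗮ = ⊥ := by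
    rw [Submodule.eq_bot_iff]
    intro x hx
    have h2 : C x = 0 := by
      rw [← @inner_self_eq_zero ℂ]
      have := (Submodule.mem_orthogonal _ x).1 hx (C (C x)) ⟨C x, rfl⟩
      exact (ContinuousLinearMap.isSelfAdjoint_iff_isSymmetric.1 hs (C x) x).symm.trans this
    exact hC (h2.trans (map_zero C).symm)
  have h2 := Submodule.topologicalClosure_eq_top_iff.2 h1
  have h3 : closure (Set.range C) = Set.univ := by
    have := congrArg (fun V : Submodule ℂ H => (V : Set H)) h2
    simp only [Submodule.topologicalClosure_coe, Submodule.top_coe] at this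
    exact this
  exact dense_iff_closure_eq.2 h3

/-- The polar decomposition of an injective selfadjoint operator. -/
theorem exists_isSelfAdjoint_mul_sqrt_eq {B : H →L[ℂ] H} (hB : IsSelfAdjoint B)
    (hinj : Function.Injective B) :
    ∃ W : H →L[ℂ] H, IsSelfAdjoint W ∧ W * W = 1 ∧ W * CFC.sqrt (B * B) = B := by
  have hnn : 0 ≤ B * B := by
    have := star_mul_self_nonneg B
    rwa [hB.star_eq] at this
  set M := CFC.sqrt (B * B) with hM
  have hMM : M * M = B * B := CFC.sqrt_mul_sqrt_self _ hnn
  have hMsa : IsSelfAdjoint M := (CFC.sqrt_nonneg (B * B)).isSelfAdjoint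
  have hMsym := ContinuousLinearMap.isSelfAdjoint_iff_isSymmetric.1 hMsa
  have hBsym := ContinuousLinearMap.isSelfAdjoint_iff_isSymmetric.1 hB
  have hMB : M * B = B * M :=
    ((show Commute (B * B) B from (Commute.refl B).mul_left (Commute.refl B)).cfcₙ_nnreal _).eq
  have hnorm : ∀ x, ‖B x‖ = ‖M x‖ := by
    intro x
    have h1 : inner ℂ (B x) (B x) = inner ℂ (M x) (M x) :=
      (hBsym x (B x)).trans ((congrArg (fun T : H →L[ℂ] H => inner ℂ x (T x)) hMM.symm).trans
        (hMsym x (M x)).symm)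
    rw [inner_self_eq_norm_sq_to_K, inner_self_eq_norm_sq_to_K] at h1
    have h2 : ‖B x‖ ^ 2 = ‖M x‖ ^ 2 := by exact_mod_cast h1
    exact (pow_left_inj₀ (norm_nonneg _) (norm_nonneg _) two_ne_zero).1 h2
  have hMinj : Function.Injective M := (injective_iff_map_eq_zero _).2 fun x hx => by
    have := hnorm x
    rw [hx, norm_zero, norm_eq_zero] at this
    exact hinj (this.trans (map_zero B).symm)
  have hMd := denseRange_of_isSelfAdjoint_of_injective hMsa hMinj
  have hBd := denseRange_of_isSelfAdjoint_of_injective hB hinj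
  let W₀ : H ≃ₗᵢ[ℂ] H := (LinearEquiv.refl ℂ H).extendOfIsometry (M : H →ₗ[ℂ] H) (B : H →ₗ[ℂ] H)
    hMd hBd hnorm
  let W : H →L[ℂ] H := W₀.toContinuousLinearEquiv
  have hWM : W * M = B := by
    ext x
    exact LinearEquiv.extendOfIsometry_eq (LinearEquiv.refl ℂ H) (M : H →ₗ[ℂ] H) (B : H →ₗ[ℂ] H)
      hMd hBd hnorm x
  have hWW : star W * W = 1 := by
    ext x
    refine ext_inner_left ℂ fun y => ?_
    change inner ℂ y ((ContinuousLinearMap.adjoint W) (W x)) = inner ℂ y x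
    rw [ContinuousLinearMap.adjoint_inner_right]
    exact W₀.inner_map_map y x
  have hsW : M * star W = B := by
    have := congrArg star hWM
    rwa [star_mul, hMsa.star_eq, hB.star_eq] at this
  have hWsa : IsSelfAdjoint W := by
    -- MW*M = BM and MWM = MB agree because M commutes with B.
    refine (mul_left_cancel_of_injective hMinj (mul_right_cancel_of_injective hMsa hMinj ?_))
    rw [hsW, mul_assoc, hWM, hMB]
  refine ⟨W, hWsa, ?_, hWM⟩
  rwa [hWsa.star_eq] at hWW

/-- -RXR and X have the same exponential and norm below π, so they coincide. -/
theorem conj_reflection_eq_neg {X R : H →L[ℂ] H} (hX : IsSelfAdjoint X) (hX1 : ‖X‖ < Real.pi)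
    (hR : IsSelfAdjoint R) (hRR : R * R = 1)
    (hU : R * NormedSpace.exp (Complex.I • X) * R = star (NormedSpace.exp (Complex.I • X))) :
    R * X * R = -X := by
  have hRu : R ∈ unitary (H →L[ℂ] H) := by
    rw [Unitary.mem_iff, hR.star_eq]
    exact ⟨hRR, hRR⟩
  have hsa : IsSelfAdjoint (-(R * X * R)) := by
    rw [isSelfAdjoint_iff, star_neg, star_mul, star_mul, hR.star_eq, hX.star_eq, mul_assoc]
  have hn : ‖-(R * X * R)‖ < Real.pi := by
    rwa [norm_neg, CStarRing.norm_mul_mem_unitary _ hRu, CStarRing.norm_mem_unitary_mul _ hRu]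
  have he : NormedSpace.exp (Complex.I • -(R * X * R)) = NormedSpace.exp (Complex.I • X) := by
    have e1 : Complex.I • -(R * X * R) = R * (-(Complex.I • X)) * R := by
      simp only [smul_neg, mul_neg, neg_mul, mul_smul_comm, smul_mul_assoc]
    rw [e1, exp_conj_of_mul_self_eq_one hRR, ← star_exp_I_smul hX, ← hU]
    calc R * (R * NormedSpace.exp (Complex.I • X) * R) * R
        = (R * R) * NormedSpace.exp (Complex.I • X) * (R * R) := by simp only [mul_assoc]
      _ = _ := by rw [hRR]; simp
  exact neg_eq_iff_eq_neg.1 (eq_of_exp_I_smul_eq hsa hX hn hX1 he)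

theorem isSelfAdjoint_reflection {P : H →L[ℂ] H} (hP : IsSelfAdjoint P) :
    IsSelfAdjoint (2 * P - 1) := by
  rw [two_mul]
  exact (hP.add hP).sub (IsSelfAdjoint.one _)

/-- Let B = P + Q - 1 = WM be the polar decomposition. M commutes with P, and BP = QB gives WP = QW.
The unitary U = WS satisfies SUS = U* = TUT and UPU* = Q, and X is its principal logarithm. -/
theorem exists_isGeodesicExponent {P Q : H →L[ℂ] H} (hP : IsStarProjection P)
    (hQ : IsStarProjection Q) (hR : RangesMeetKernelsTrivially P Q)
    (hK : IsCompactOperator (P * Q * P)) (hinf : ¬ FiniteDimensional ℂ P.range) :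
    ∃ X : H →L[ℂ] H, IsGeodesicExponent P Q X := by
  have hPP := hP.isIdempotentElem.eq
  have hQQ := hQ.isIdempotentElem.eq
  set B := P + Q - 1 with hBdef
  have hB : IsSelfAdjoint B := (hP.isSelfAdjoint.add hQ.isSelfAdjoint).sub (IsSelfAdjoint.one _)
  have hBinj : Function.Injective B := injective_add_sub_one_of_rangesMeetKernelsTrivially hP hQ hR
  obtain ⟨W, hW, hWW, hWM⟩ := exists_isSelfAdjoint_mul_sqrt_eq hB hBinj
  have hnn : 0 ≤ B * B := by
    have := star_mul_self_nonneg B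
    rwa [hB.star_eq] at this
  set M := CFC.sqrt (B * B) with hM
  have hMM : M * M = B * B := CFC.sqrt_mul_sqrt_self _ hnn
  have hM0 : 0 ≤ M := CFC.sqrt_nonneg (B * B)
  have hMsa : IsSelfAdjoint M := hM0.isSelfAdjoint
  have hMP : M * P = P * M := by
    refine ((show Commute (B * B) P from ?_).cfcₙ_nnreal _).eq
    exact (sq_add_sub_one_mul hPP hQQ).trans (mul_sq_add_sub_one hPP hQQ).symm
  have hMinj : Function.Injective M := (injective_iff_map_eq_zero _).2 fun x hx => by
    have h1 : B x = 0 := by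
      rw [← hWM]
      change W (M x) = 0
      rw [hx, map_zero]
    exact hBinj (h1.trans (map_zero B).symm)
  have hWP : W * P = Q * W := by
    refine mul_right_cancel_of_injective hMsa hMinj ?_
    rw [mul_assoc, mul_assoc, hWM, ← hMP, ← mul_assoc, hWM, hBdef]
    have e1 : (P + Q - 1) * P = P * P + Q * P - P := by noncomm_ring
    have e2 : Q * (P + Q - 1) = Q * P + Q * Q - Q := by noncomm_ring
    rw [e1, e2, hPP, hQQ]
    abel
  set S := 2 * P - 1 with hS
  set T := 2 * Q - 1 with hT
  have hSS : S * S = 1 := reflection_mul_self hPP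
  have hSsa : IsSelfAdjoint S := isSelfAdjoint_reflection hP.isSelfAdjoint
  have hTsa : IsSelfAdjoint T := isSelfAdjoint_reflection hQ.isSelfAdjoint
  have hTT : T * T = 1 := reflection_mul_self hQQ
  have hWS : W * S = T * W := by
    rw [hS, hT, mul_sub, sub_mul, mul_one, one_mul, two_mul, two_mul, mul_add, add_mul, hWP]
  have hMS : M * S = S * M := by
    rw [hS, mul_sub, sub_mul, mul_one, one_mul, two_mul, mul_add, add_mul, hMP]
  set U := W * S with hUdef
  have hUstar : star U = S * W := by rw [hUdef, star_mul, hW.star_eq, hSsa.star_eq]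
  have hUu : U ∈ unitary (H →L[ℂ] H) := by
    rw [Unitary.mem_iff, hUstar, hUdef]
    constructor
    · rw [mul_assoc, ← mul_assoc W, hWW, one_mul, hSS]
    · rw [mul_assoc, ← mul_assoc S, hSS, one_mul, hWW]
  have hUM : U + star U = 2 * M := by
    refine mul_right_cancel_of_injective hMsa hMinj ?_
    rw [hUstar, hUdef, add_mul, mul_assoc, ← hMS, ← mul_assoc, hWM, mul_assoc, hWM, mul_assoc, hMM,
      hBdef, hS]
    have e1 : (P + Q - 1) * (2 * P - 1) + (2 * P - 1) * (P + Q - 1) =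
      4 * (P * P) + 2 * (Q * P) + 2 * (P * Q) - 4 * P - 2 * Q - 2 * P + 1 + 1 := by noncomm_ring
    have e2 : 2 * ((P + Q - 1) * (P + Q - 1)) =
      2 * (P * P) + 2 * (Q * Q) + 2 * (Q * P) + 2 * (P * Q) - 4 * P - 4 * Q + 1 + 1 := by
      noncomm_ring
    rw [e1, e2, hPP, hQQ]
    noncomm_ring
  have hnt : Nontrivial (H →L[ℂ] H) := by
    by_contra hsub
    rw [not_nontrivial_iff_subsingleton] at hsub
    apply hinf
    rw [Subsingleton.elim P 0]
    have : (0 : H →L[ℂ] H).range = ⊥ := LinearMap.range_zero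
    rw [this]
    infer_instance
  have hM1 : M ≤ 1 := by
    rw [← CStarAlgebra.norm_le_one_iff_of_nonneg M hM0]
    have h1 : (2 : ℝ) * ‖M‖ ≤ 2 := by
      calc (2 : ℝ) * ‖M‖ = ‖(2 : ℂ) • M‖ := by rw [norm_smul]; simp
        _ = ‖U + star U‖ := by rw [hUM, two_smul, two_mul]
        _ ≤ ‖U‖ + ‖star U‖ := norm_add_le _ _
        _ = 2 := by
          rw [norm_star, CStarRing.norm_of_mem_unitary hUu]
          norm_num
    linarith
  -- Otherwise M would be invertible and P = M⁻²(PQP) a compact projection of infinite rank.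
  have hnorm1 : ‖1 - M‖ = 1 := by
    refine le_antisymm ((CStarAlgebra.norm_le_one_iff_of_nonneg (1 - M) (sub_nonneg.2 hM1)).2
      (sub_le_self _ hM0)) (not_lt.1 fun hlt => ?_)
    have hu : IsUnit M := by
      have := isUnit_one_sub_of_norm_lt_one hlt
      rwa [sub_sub_cancel] at this
    obtain ⟨u, hu⟩ := hMM ▸ hu.mul hu
    have hPc : IsCompactOperator P := by
      have : P = (u⁻¹ : (H →L[ℂ] H)ˣ) * (P * Q * P) := by
        rw [← sq_add_sub_one_mul hPP hQQ, ← hBdef, ← mul_assoc, ← hu, Units.inv_mul, one_mul]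
      rw [this]
      exact hK.clm_mul _
    exact hinf (hPc.finiteDimensional_range_of_isIdempotentElem hPP)
  -- |U - 1|² = 2 - U - U* = 2(1 - M). The value 2 corresponds to the angle arccos 0 = π/2.
  have hUnorm : ‖U - 1‖ ^ 2 = 2 := by
    have h1 : star (U - 1) * (U - 1) = (2 : ℂ) • (1 - M) := by
      have : star (U - 1) * (U - 1) = star U * U - (U + star U) + 1 := by
        rw [star_sub, star_one]; noncomm_ring
      rw [this, hUM, (Unitary.mem_iff.1 hUu).1, two_smul]
      noncomm_ring
    rw [pow_two, ← CStarRing.norm_star_mul_self, h1, norm_smul, hnorm1]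
    simp
  have hU2 : ‖U - 1‖ < 2 := by
    by_contra hge
    rw [not_lt] at hge
    nlinarith
  set X : H →L[ℂ] H := (Unitary.argSelfAdjoint ⟨U, hUu⟩ : selfAdjoint (H →L[ℂ] H)).1 with hX
  have hXsa : IsSelfAdjoint X := (Unitary.argSelfAdjoint ⟨U, hUu⟩).2
  have hexp : NormedSpace.exp (Complex.I • X) = U :=
    congrArg Subtype.val (expUnitary_argSelfAdjoint (u := ⟨U, hUu⟩) hU2)
  have hXnorm : ‖X‖ = Real.pi / 2 := by
    have h1 : ‖X‖ = Real.arccos (1 - ‖U - 1‖ ^ 2 / 2) :=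
      Unitary.norm_argSelfAdjoint (u := ⟨U, hUu⟩) hU2
    rw [h1, hUnorm]
    norm_num
  have hXpi : ‖X‖ < Real.pi := by rw [hXnorm]; linarith [Real.pi_pos]
  refine ⟨X, hXsa, hXnorm, ?_, ?_, ?_⟩
  · refine (isCodiagonal_iff hPP).2 (conj_reflection_eq_neg hXsa hXpi hSsa hSS ?_)
    rw [hexp, hUstar, hUdef, mul_assoc, mul_assoc, hSS, mul_one]
  · refine (isCodiagonal_iff hQQ).2 (conj_reflection_eq_neg hXsa hXpi hTsa hTT ?_)
    rw [hexp, hUstar, hWS, ← mul_assoc, hTT, one_mul, ← hT]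
    have h1 := congrArg star hWS
    rw [star_mul, star_mul, hSsa.star_eq, hTsa.star_eq, hW.star_eq] at h1
    exact h1.symm
  · rw [← star_exp_I_smul hXsa, hexp, hUstar, hUdef]
    have hSP : S * P * S = P := by
      have : S * P * S = 4 * (P * P * P) - 4 * (P * P) + P := by rw [hS]; noncomm_ring
      rw [this, hPP, hPP]; noncomm_ring
    calc W * S * P * (S * W) = W * (S * P * S) * W := by simp only [mul_assoc]
      _ = Q := by rw [hSP, hWP, mul_assoc, hWW, mul_one]

end Existence

/-! ### Bounded Hilbert-Schmidt sums imply compactness -/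

section HilbertSchmidt
variable {H : Type*} [NormedAddCommGroup H] [InnerProductSpace ℂ H]

theorem exists_orthonormal_norm_apply_le {A : H →L[ℂ] H} {C : ℝ}
    (hA : ∀ (m : ℕ) (v : Fin m → H), Orthonormal ℂ v → ∑ i, ‖A (v i)‖ ^ 2 ≤ C)
    {ε : ℝ} (hε : 0 < ε) :
    ∃ V : Submodule ℂ H, FiniteDimensional ℂ V ∧ ∀ x ∈ Vᗮ, ‖A x‖ ≤ ε * ‖x‖ := by
  let s : Set ℝ := {r | ∃ (m : ℕ) (v : Fin m → H), Orthonormal ℂ v ∧ r = ∑ i, ‖A (v i)‖ ^ 2}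
  have hbdd : BddAbove s := ⟨C, by rintro _ ⟨m, v, hv, rfl⟩; exact hA m v hv⟩
  have hne : s.Nonempty := ⟨_, 0, Fin.elim0, Orthonormal.of_isEmpty _, rfl⟩
  -- For a system within ε² of the supremum, one more orthogonal unit vector u adds ‖Au‖² ≤ ε².
  obtain ⟨_, ⟨m, v, hv, rfl⟩, hlt⟩ := exists_lt_of_lt_csSup hne
    (sub_lt_self (sSup s) (pow_pos hε 2))
  refine ⟨Submodule.span ℂ (Set.range v), FiniteDimensional.span_of_finite ℂ (Set.finite_range v),
    fun x hx => ?_⟩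
  by_cases hx0 : x = 0
  · simp [hx0]
  have hxn : 0 < ‖x‖ := norm_pos_iff.2 hx0
  let u : H := ((‖x‖⁻¹ : ℝ) : ℂ) • x
  have hu : ‖u‖ = 1 := by simp [u, norm_smul, hxn.ne']
  have huv : ∀ i, inner ℂ u (v i) = 0 := by
    intro i
    have : inner ℂ (v i) x = 0 :=
      (Submodule.mem_orthogonal _ x).1 hx _ (Submodule.subset_span ⟨i, rfl⟩)
    rw [inner_smul_left, ← inner_conj_symm, this]
    simp
  have ho : Orthonormal ℂ (Matrix.vecCons u v) := orthonormal_vecCons_iff.2 ⟨hu, huv, hv⟩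
  have h1 : ∑ i, ‖A (Matrix.vecCons u v i)‖ ^ 2 ≤ sSup s := le_csSup hbdd ⟨_, _, ho, rfl⟩
  rw [Fin.sum_univ_succ] at h1
  simp only [Matrix.cons_val_zero, Matrix.cons_val_succ] at h1
  have h2 : ‖A u‖ ^ 2 ≤ ε ^ 2 := by linarith
  have h3 : ‖A u‖ ≤ ε := (pow_le_pow_iff_left₀ (norm_nonneg _) hε.le two_ne_zero).1 h2
  have h4 : ‖A u‖ = ‖x‖⁻¹ * ‖A x‖ := by simp [u, norm_smul]
  rw [h4, inv_mul_le_iff₀ hxn, mul_comm] at h3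
  exact h3

/-- An operator with bounded Hilbert-Schmidt sums is a norm limit of operators of finite rank, and
so is its adjoint. -/
theorem isCompactOperator_of_sum_norm_sq_le [CompleteSpace H] {A : H →L[ℂ] H} {C : ℝ}
    (hA : ∀ (m : ℕ) (v : Fin m → H), Orthonormal ℂ v → ∑ i, ‖A (v i)‖ ^ 2 ≤ C) :
    IsCompactOperator A ∧ IsCompactOperator (star A : H →L[ℂ] H) := by
  have key : ∀ k : ℕ, ∃ E : H →L[ℂ] H, IsCompactOperator E ∧ IsSelfAdjoint E ∧
      ‖A * E - A‖ ≤ 1 / ((k : ℝ) + 1) := by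
    intro k
    obtain ⟨V, hV, hle⟩ := exists_orthonormal_norm_apply_le hA
      (by positivity : (0 : ℝ) < 1 / ((k : ℝ) + 1))
    refine ⟨V.starProjection, ?_, isSelfAdjoint_starProjection V, ?_⟩
    · have h : IsCompactOperator V.orthogonalProjectionOnto :=
        have : ProperSpace V := FiniteDimensional.proper ℂ V
        isCompactOperator_of_locallyCompactSpace_dom V.orthogonalProjectionOnto
      exact h.clm_comp V.subtypeL
    · refine ContinuousLinearMap.opNorm_le_bound _ (by positivity) fun x => ?_
      have h1 : (A * V.starProjection - A) x = -(A (x - V.starProjection x)) := by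
        simp [map_sub]
      rw [h1, norm_neg]
      refine (hle _ (V.sub_starProjection_mem_orthogonal x)).trans ?_
      gcongr
      have h2 := V.sub_starProjection_mem_orthogonal x
      have h3 : inner ℂ (V.starProjection x) (x - V.starProjection x) = 0 :=
        (Submodule.mem_orthogonal _ _).1 h2 _ (V.starProjection_apply_mem x)
      have h4 := norm_add_sq_eq_norm_sq_add_norm_sq_of_inner_eq_zero _ _ h3
      rw [add_sub_cancel] at h4
      nlinarith [norm_nonneg x, norm_nonneg (x - V.starProjection x),
        mul_self_nonneg ‖V.starProjection x‖]
  choose E hE hEs hle using key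
  have hlim : Tendsto (fun k => A * E k) atTop (𝓝 A) := by
    rw [tendsto_iff_norm_sub_tendsto_zero]
    exact squeeze_zero (fun _ => norm_nonneg _) hle tendsto_one_div_add_atTop_nhds_zero_nat
  refine ⟨isCompactOperator_of_tendsto hlim (Eventually.of_forall fun k => (hE k).clm_mul A), ?_⟩
  have hlim' : Tendsto (fun k => star (A * E k)) atTop (𝓝 (star A)) := hlim.star
  refine isCompactOperator_of_tendsto hlim' (Eventually.of_forall fun k => ?_)
  rw [star_mul, (hEs k).star_eq]
  exact (hE k).mul_clm _

end HilbertSchmidt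

/-! ### The time and frequency projections -/

section TimeProjection
variable {n : ℕ} {I J : Set (EuclideanSpace ℝ (Fin n))}

theorem coeFn_projTime (hI : NullMeasurableSet I volume) (f : L2Rn n) :
    projTime hI f =ᵐ[volume] I.indicator f := (memLp_indicator hI f).coeFn_toLp

theorem projTime_mul_projTime (hI : NullMeasurableSet I volume) (hJ : NullMeasurableSet J volume) :
    projTime hI * projTime hJ = projTime (hI.inter hJ) := by
  ext f
  change projTime hI (projTime hJ f) =ᵐ[volume] projTime (hI.inter hJ) f
  filter_upwards [coeFn_projTime hI (projTime hJ f), coeFn_projTime hJ f,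
    coeFn_projTime (hI.inter hJ) f] with x h1 h2 h3
  rw [h1, h3, ← Set.indicator_indicator]
  by_cases hx : x ∈ I
  · rw [Set.indicator_of_mem hx, Set.indicator_of_mem hx, h2]
  · rw [Set.indicator_of_notMem hx, Set.indicator_of_notMem hx]

theorem projTime_eq_zero (hI : NullMeasurableSet I volume) (h0 : volume I = 0) :
    projTime hI = 0 := by
  ext f
  have h1 : ∀ᵐ x ∂(volume : Measure (EuclideanSpace ℝ (Fin n))), x ∉ I :=
    measure_eq_zero_iff_ae_notMem.1 h0
  filter_upwards [coeFn_projTime hI f, h1, Lp.coeFn_zero ℂ 2 volume] with x hx hxI h0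
  rw [hx, Set.indicator_of_notMem hxI]
  exact h0.symm

theorem isStarProjection_projTime (hI : NullMeasurableSet I volume) :
    IsStarProjection (projTime hI) := by
  refine ⟨?_, ?_⟩
  · have := projTime_mul_projTime hI hI
    simp only [Set.inter_self] at this
    exact this
  · rw [ContinuousLinearMap.isSelfAdjoint_iff_isSymmetric]
    intro f g
    change inner ℂ (projTime hI f) g = inner ℂ f (projTime hI g)
    rw [L2.inner_def, L2.inner_def]
    refine integral_congr_ae ?_
    filter_upwards [coeFn_projTime hI f, coeFn_projTime hI g] with x h1 h2
    rw [h1, h2]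
    by_cases hx : x ∈ I
    · rw [Set.indicator_of_mem hx, Set.indicator_of_mem hx]
    · rw [Set.indicator_of_notMem hx, Set.indicator_of_notMem hx, inner_zero_left, inner_zero_right]

theorem isStarProjection_projFreq (hJ : NullMeasurableSet J volume) :
    IsStarProjection (projFreq hJ) := by
  set F := Lp.fourierTransformₗᵢ (EuclideanSpace ℝ (Fin n)) ℂ with hF
  have happ : ∀ f, projFreq hJ f = F.symm (projTime hJ (F f)) := fun _ => rfl
  have hP := isStarProjection_projTime hJ
  refine ⟨?_, ?_⟩
  · refine ContinuousLinearMap.ext fun f => ?_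
    change projFreq hJ (projFreq hJ f) = projFreq hJ f
    rw [happ, happ, F.apply_symm_apply, hP.apply_apply]
  · rw [ContinuousLinearMap.isSelfAdjoint_iff_isSymmetric]
    intro f g
    change inner ℂ (projFreq hJ f) g = inner ℂ f (projFreq hJ g)
    rw [happ, happ, ← F.inner_map_map, F.apply_symm_apply, hP.inner_left, ← F.inner_map_map f,
      F.apply_symm_apply]

theorem integrable_projTime (hI : NullMeasurableSet I volume) (hI1 : volume I < ∞) (f : L2Rn n) :
    Integrable (projTime hI f) volume := by
  rw [integrable_congr (coeFn_projTime hI f)]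
  refine IntegrableOn.integrable_indicator₀ ?_ hI
  have : IsFiniteMeasure (volume.restrict I) := ⟨by simpa using hI1⟩
  exact ((Lp.memLp f).restrict I).integrable one_le_two

theorem norm_projTime_sq (hI : NullMeasurableSet I volume) (f : L2Rn n) :
    ‖projTime hI f‖ ^ 2 = ∫ x in I, ‖f x‖ ^ 2 := by
  have h1 : ((‖projTime hI f‖ ^ 2 : ℝ) : ℂ) = ((∫ x in I, ‖f x‖ ^ 2 : ℝ) : ℂ) := by
    rw [← integral_indicator₀ hI, ← integral_complex_ofReal]
    have := inner_self_eq_norm_sq_to_K (𝕜 := ℂ) (projTime hI f)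
    push_cast
    refine this.symm.trans ?_
    rw [L2.inner_def]
    refine integral_congr_ae ?_
    filter_upwards [coeFn_projTime hI f] with x hx
    rw [hx, inner_self_eq_norm_sq_to_K]
    by_cases hxI : x ∈ I <;> simp [hxI]
  exact_mod_cast h1

end TimeProjection

/-! ### The Plancherel transform as an integral on L¹ ∩ L² -/

section FourierIntegral
open scoped FourierTransform
variable {n : ℕ}

/-- Against a test function φ both sides integrate to ∫ φ̂ f: one by duality of tempered
distributions, the other by the multiplication formula for integrable functions. -/
theorem fourier_coeFn_ae_eq (f : L2Rn n) (hf : Integrable f volume) :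
    Lp.fourierTransformₗᵢ (EuclideanSpace ℝ (Fin n)) ℂ f =ᵐ[volume]
      𝓕 (f : EuclideanSpace ℝ (Fin n) → ℂ) := by
  set Ff : L2Rn n := Lp.fourierTransformₗᵢ (EuclideanSpace ℝ (Fin n)) ℂ f with hFf
  have hcont : Continuous (𝓕 (f : EuclideanSpace ℝ (Fin n) → ℂ)) :=
    VectorFourier.fourierIntegral_continuous Real.continuous_fourierChar
      (by exact continuous_inner) hf
  refine ae_eq_of_integral_contDiff_smul_eq ((Lp.memLp Ff).locallyIntegrable one_le_two)
    hcont.locallyIntegrable fun g hg hgc => ?_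
  have hg₁ : HasCompactSupport (Complex.ofRealCLM ∘ g) := hgc.comp_left rfl
  have hg₂ : ContDiff ℝ _ (Complex.ofRealCLM ∘ g) := Complex.ofRealCLM.contDiff.comp hg
  set φ := hg₁.toSchwartzMap hg₂ with hφ
  have hφg : ∀ x, φ x = (g x : ℂ) := fun x => rfl
  have h1 : ∫ x, φ x • Ff x = ∫ x, (𝓕 φ) x • f x := by
    have := congrArg (fun T => T φ) (Lp.fourier_toTemperedDistribution_eq f)
    simp only [TemperedDistribution.fourier_apply, Lp.toTemperedDistribution_apply] at this
    exact this.symm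
  have h2 : ∫ x, (𝓕 φ) x • f x = ∫ x, φ x • 𝓕 (f : EuclideanSpace ℝ (Fin n) → ℂ) x := by
    have := VectorFourier.integral_fourierIntegral_smul_eq_flip (μ := volume) (ν := volume)
      (L := innerₗ (EuclideanSpace ℝ (Fin n))) (f := φ) (g := f) Real.continuous_fourierChar
      (by exact continuous_inner) φ.integrable hf
    rw [flip_innerₗ] at this
    rw [SchwartzMap.fourier_coe]
    exact this
  simpa only [hφg, Complex.real_smul, smul_eq_mul] using h1.trans h2

theorem fourier_symm_coeFn_ae_eq (f : L2Rn n) (hf : Integrable f volume) :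
    (Lp.fourierTransformₗᵢ (EuclideanSpace ℝ (Fin n)) ℂ).symm f =ᵐ[volume]
      𝓕⁻ (f : EuclideanSpace ℝ (Fin n) → ℂ) := by
  set Ff : L2Rn n := (Lp.fourierTransformₗᵢ (EuclideanSpace ℝ (Fin n)) ℂ).symm f with hFf
  have hL : Continuous fun p : EuclideanSpace ℝ (Fin n) × EuclideanSpace ℝ (Fin n) =>
      (-innerₗ (EuclideanSpace ℝ (Fin n))) p.1 p.2 := by
    exact continuous_inner.neg
  have hcont : Continuous (𝓕⁻ (f : EuclideanSpace ℝ (Fin n) → ℂ)) :=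
    VectorFourier.fourierIntegral_continuous Real.continuous_fourierChar hL hf
  refine ae_eq_of_integral_contDiff_smul_eq ((Lp.memLp Ff).locallyIntegrable one_le_two)
    hcont.locallyIntegrable fun g hg hgc => ?_
  have hg₁ : HasCompactSupport (Complex.ofRealCLM ∘ g) := hgc.comp_left rfl
  have hg₂ : ContDiff ℝ _ (Complex.ofRealCLM ∘ g) := Complex.ofRealCLM.contDiff.comp hg
  set φ := hg₁.toSchwartzMap hg₂ with hφ
  have hφg : ∀ x, φ x = (g x : ℂ) := fun x => rfl
  have h1 : ∫ x, φ x • Ff x = ∫ x, (𝓕⁻ φ) x • f x := by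
    have := congrArg (fun T => T φ) (Lp.fourierInv_toTemperedDistribution_eq f)
    simp only [TemperedDistribution.fourierInv_apply, Lp.toTemperedDistribution_apply] at this
    exact this.symm
  have h2 : ∫ x, (𝓕⁻ φ) x • f x = ∫ x, φ x • 𝓕⁻ (f : EuclideanSpace ℝ (Fin n) → ℂ) x := by
    have := VectorFourier.integral_fourierIntegral_smul_eq_flip (μ := volume) (ν := volume)
      (L := -innerₗ (EuclideanSpace ℝ (Fin n))) (f := φ) (g := f) Real.continuous_fourierChar
      hL φ.integrable hf
    have hflip : (-innerₗ (EuclideanSpace ℝ (Fin n))).flip = -innerₗ _ := by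
      ext x y
      simp [real_inner_comm]
    rw [hflip] at this
    rw [SchwartzMap.fourierInv_coe]
    exact this
  simpa only [hφg, Complex.real_smul, smul_eq_mul] using h1.trans h2

end FourierIntegral

/-! ### Compactness of Q_J P_I -/

section FourierKernel
open scoped FourierTransform
variable {n : ℕ} {I J : Set (EuclideanSpace ℝ (Fin n))}

theorem memLp_indicator_fourierChar (hI : NullMeasurableSet I volume) (hI1 : volume I < ∞)
    (ξ : EuclideanSpace ℝ (Fin n)) :
    MemLp (I.indicator fun x => (Real.fourierChar (inner ℝ x ξ) : ℂ)) 2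
      (volume : Measure (EuclideanSpace ℝ (Fin n))) := by
  have hc : Continuous fun x : EuclideanSpace ℝ (Fin n) =>
      (Real.fourierChar (inner ℝ x ξ) : ℂ) :=
    continuous_subtype_val.comp (Real.continuous_fourierChar.comp
      (continuous_id.inner continuous_const))
  have hone : MemLp ((toMeasurable volume I).indicator fun _ => (1 : ℂ)) 2
      (volume : Measure (EuclideanSpace ℝ (Fin n))) :=
    memLp_indicator_const 2 (measurableSet_toMeasurable _ _) 1
      (Or.inr (by rw [measure_toMeasurable]; exact hI1.ne))
  refine hone.mono (hc.aestronglyMeasurable.indicator₀ hI) (Eventually.of_forall fun x => ?_)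
  by_cases hx : x ∈ I
  · rw [Set.indicator_of_mem hx, Set.indicator_of_mem (subset_toMeasurable _ _ hx), norm_one]
    exact (Circle.norm_coe _).le
  · rw [Set.indicator_of_notMem hx, norm_zero]
    exact norm_nonneg _

theorem inner_fourierChar_eq (hI : NullMeasurableSet I volume) (hI1 : volume I < ∞)
    (ξ : EuclideanSpace ℝ (Fin n)) (f : L2Rn n) :
    inner ℂ ((memLp_indicator_fourierChar hI hI1 ξ).toLp _) f =
      𝓕 (projTime hI f : EuclideanSpace ℝ (Fin n) → ℂ) ξ := by
  rw [L2.inner_def, Real.fourier_eq]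
  refine integral_congr_ae ?_
  filter_upwards [(memLp_indicator_fourierChar hI hI1 ξ).coeFn_toLp, coeFn_projTime hI f]
    with x h1 h2
  rw [h1, h2]
  by_cases hx : x ∈ I
  · rw [Set.indicator_of_mem hx, Set.indicator_of_mem hx, RCLike.inner_apply, AddChar.map_neg_eq_inv,
      Circle.smul_def, Circle.coe_inv_eq_conj, smul_eq_mul, mul_comm]
  · rw [Set.indicator_of_notMem hx, Set.indicator_of_notMem hx, inner_zero_left, smul_zero]

theorem norm_toLp_fourierChar_sq (hI : NullMeasurableSet I volume) (hI1 : volume I < ∞)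
    (ξ : EuclideanSpace ℝ (Fin n)) :
    ‖(memLp_indicator_fourierChar hI hI1 ξ).toLp _‖ ^ 2 = volume.real I := by
  have h1 : ((‖(memLp_indicator_fourierChar hI hI1 ξ).toLp _‖ ^ 2 : ℝ) : ℂ) =
      ((volume.real I : ℝ) : ℂ) := by
    have h2 : volume.real I = ∫ x in I, (1 : ℝ) := by simp
    rw [h2, ← integral_indicator₀ hI, ← integral_complex_ofReal]
    have := inner_self_eq_norm_sq_to_K (𝕜 := ℂ) ((memLp_indicator_fourierChar hI hI1 ξ).toLp _)
    push_cast
    refine this.symm.trans ?_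
    rw [L2.inner_def]
    refine integral_congr_ae ?_
    filter_upwards [(memLp_indicator_fourierChar hI hI1 ξ).coeFn_toLp] with x hx
    rw [hx, inner_self_eq_norm_sq_to_K]
    by_cases hxI : x ∈ I
    · rw [Set.indicator_of_mem hxI, Set.indicator_of_mem hxI, Circle.norm_coe]
      simp
    · simp [hxI]
  exact_mod_cast h1

/-- At almost every ξ the transform of P_I v is the inner product of v with the character at ξ cut
off to I, of squared norm |I|. Bessel's inequality bounds the sum pointwise by |I|; integration over
J gives |I||J|. -/
theorem sum_norm_projTime_fourier_sq_le (hI : NullMeasurableSet I volume)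
    (hJ : NullMeasurableSet J volume) (hI1 : volume I < ∞) (hJ1 : volume J < ∞)
    {m : ℕ} {v : Fin m → L2Rn n} (hv : Orthonormal ℂ v) :
    ∑ i, ‖projTime hJ (Lp.fourierTransformₗᵢ (EuclideanSpace ℝ (Fin n)) ℂ (projTime hI (v i)))‖ ^ 2
      ≤ volume.real I * volume.real J := by
  set F := Lp.fourierTransformₗᵢ (EuclideanSpace ℝ (Fin n)) ℂ with hF
  have hint : ∀ i, IntegrableOn (fun x => ‖F (projTime hI (v i)) x‖ ^ 2) J volume := fun i =>
    ((memLp_two_iff_integrable_sq_norm (Lp.aestronglyMeasurable _)).1 (Lp.memLp _)).integrableOn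
  simp only [norm_projTime_sq]
  rw [← integral_finsetSum _ fun i _ => hint i]
  have hJfin : IsFiniteMeasure (volume.restrict J) := ⟨by simpa using hJ1⟩
  have hconst : ∫ _ in J, volume.real I = volume.real I * volume.real J := by
    rw [integral_const]
    simp [mul_comm]
  rw [← hconst]
  refine integral_mono_ae (integrable_finsetSum _ fun i _ => hint i) (integrable_const _)
    (ae_restrict_of_ae ?_)
  have hall : ∀ᵐ ξ ∂(volume : Measure (EuclideanSpace ℝ (Fin n))), ∀ i,
      F (projTime hI (v i)) ξ = 𝓕 (projTime hI (v i) : EuclideanSpace ℝ (Fin n) → ℂ) ξ :=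
    ae_all_iff.2 fun i => fourier_coeFn_ae_eq _ (integrable_projTime hI hI1 _)
  filter_upwards [hall] with ξ hξ
  simp only [hξ, ← inner_fourierChar_eq hI hI1 ξ]
  rw [← norm_toLp_fourierChar_sq hI hI1 ξ]
  refine le_trans (le_of_eq ?_) (hv.sum_inner_products_le
    ((memLp_indicator_fourierChar hI hI1 ξ).toLp _) (s := Finset.univ))
  refine Finset.sum_congr rfl fun i _ => ?_
  rw [norm_inner_symm]

theorem isCompactOperator_projFreq_mul_projTime (hI : NullMeasurableSet I volume)
    (hJ : NullMeasurableSet J volume) (hI1 : volume I < ∞) (hJ1 : volume J < ∞) :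
    IsCompactOperator (projFreq hJ * projTime hI) ∧
      IsCompactOperator (projTime hI * projFreq hJ) := by
  have h := isCompactOperator_of_sum_norm_sq_le (A := projFreq hJ * projTime hI)
    (C := volume.real I * volume.real J) fun m v hv => by
      refine le_trans (le_of_eq ?_) (sum_norm_projTime_fourier_sq_le hI hJ hI1 hJ1 hv)
      refine Finset.sum_congr rfl fun i _ => ?_
      congr 1
      exact (Lp.fourierTransformₗᵢ (EuclideanSpace ℝ (Fin n)) ℂ).symm.norm_map _
  rw [star_mul, (isStarProjection_projTime hI).isSelfAdjoint.star_eq,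
    (isStarProjection_projFreq hJ).isSelfAdjoint.star_eq] at h
  exact h

end FourierKernel

/-! ### Fourier transforms vanishing on a set of positive measure -/

section UniqueContinuation
open scoped FourierTransform

theorem eq_zero_of_volume_setOf_eq_zero_ne_zero {φ : ℂ → ℂ} (hφ : Differentiable ℂ φ)
    {S : Set ℝ} (hS : volume S ≠ 0) (hSb : S ⊆ Set.Icc 1 2) (hz : ∀ t ∈ S, φ (t : ℂ) = 0) (z : ℂ) :
    φ z = 0 := by
  have hinf : S.Infinite := fun hf => hS (hf.measure_zero _)
  obtain ⟨a, -, ha⟩ := hinf.exists_accPt_of_subset_isCompact isCompact_Icc hSb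
  have hfreq : ∃ᶠ w in 𝓝[≠] (a : ℂ), φ w = 0 := by
    have h1 : ∃ᶠ t in 𝓝[≠] a, t ∈ S := accPt_iff_frequently_nhdsNE.1 ha
    have h2 : Tendsto (fun t : ℝ => (t : ℂ)) (𝓝[≠] a) (𝓝[≠] (a : ℂ)) :=
      Complex.continuous_ofReal.continuousAt.continuousWithinAt.tendsto_nhdsWithin
        fun t ht => fun h => ht (Complex.ofReal_injective h)
    exact h2.frequently (h1.mono fun t ht => hz t ht)
  have han : AnalyticOnNhd ℂ φ Set.univ := fun w _ => hφ.analyticAt w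
  exact han.eqOn_zero_of_preconnected_of_frequently_eq_zero isPreconnected_univ (Set.mem_univ _)
    hfreq (Set.mem_univ z)

variable {n : ℕ}

/-- The frequency b is bounded where g ≠ 0, which dominates the derivative locally uniformly in z.
-/
theorem differentiable_integral_exp_mul {α : Type*} [MeasurableSpace α] {μ : Measure α} {g : α → ℂ}
    (hg : Integrable g μ) {b : α → ℝ} (hb : AEStronglyMeasurable b μ) {M : ℝ}
    (hM : ∀ x, g x ≠ 0 → |b x| ≤ M) :
    Differentiable ℂ fun z : ℂ => ∫ x, Complex.exp (z * (b x * Complex.I)) * g x ∂μ := by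
  intro z₀
  have hb' : AEStronglyMeasurable (fun x => (b x : ℂ)) μ :=
    Complex.continuous_ofReal.comp_aestronglyMeasurable hb
  have hmeas : ∀ z : ℂ, AEStronglyMeasurable
      (fun x => Complex.exp (z * (b x * Complex.I)) * g x) μ := fun z =>
    (Complex.continuous_exp.comp_aestronglyMeasurable
      ((hb'.mul_const Complex.I).const_mul z)).mul hg.aestronglyMeasurable
  have hnorm : ∀ z : ℂ, ∀ x, g x ≠ 0 →
      ‖Complex.exp (z * (b x * Complex.I))‖ ≤ Real.exp (‖z‖ * |M|) := by
    intro z x hx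
    rw [Complex.norm_exp]
    refine Real.exp_le_exp.2 ((Complex.re_le_norm _).trans ?_)
    rw [norm_mul, norm_mul, Complex.norm_I, mul_one, Complex.norm_real, Real.norm_eq_abs]
    exact mul_le_mul_of_nonneg_left ((hM x hx).trans (le_abs_self M)) (norm_nonneg z)
  have h := hasDerivAt_integral_of_dominated_loc_of_deriv_le (μ := μ) (𝕜 := ℂ)
    (F := fun z x => Complex.exp (z * (b x * Complex.I)) * g x)
    (F' := fun z x => Complex.exp (z * (b x * Complex.I)) * (b x * Complex.I) * g x)
    (x₀ := z₀) (s := Metric.ball z₀ 1) (bound := fun x => Real.exp ((‖z₀‖ + 1) * |M|) * |M| * ‖g x‖)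
    (Metric.ball_mem_nhds _ one_pos) (Eventually.of_forall hmeas) ?_ ?_ ?_ ?_ ?_
  · exact h.2.differentiableAt
  · refine (hg.norm.const_mul (Real.exp (‖z₀‖ * |M|))).mono' (hmeas z₀)
      (Eventually.of_forall fun x => ?_)
    by_cases hx : g x = 0
    · simp [hx]
    · rw [norm_mul]
      gcongr
      exact hnorm z₀ x hx
  · exact ((Complex.continuous_exp.comp_aestronglyMeasurable
      ((hb'.mul_const Complex.I).const_mul z₀)).mul (hb'.mul_const Complex.I)).mul
      hg.aestronglyMeasurable
  · refine Eventually.of_forall fun x z hz => ?_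
    by_cases hx : g x = 0
    · simp [hx]
    · rw [norm_mul, norm_mul]
      have h1 : ‖z‖ ≤ ‖z₀‖ + 1 := by
        have := norm_sub_norm_le z z₀
        rw [Metric.mem_ball, dist_eq_norm] at hz
        linarith
      have h2 : ‖(b x : ℂ) * Complex.I‖ ≤ |M| := by
        rw [norm_mul, Complex.norm_I, mul_one, Complex.norm_real, Real.norm_eq_abs]
        exact (hM x hx).trans (le_abs_self M)
      have h3 : ‖Complex.exp (z * (b x * Complex.I))‖ ≤ Real.exp ((‖z₀‖ + 1) * |M|) :=
        (hnorm z x hx).trans (Real.exp_le_exp.2 (by gcongr))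
      gcongr
  · exact hg.norm.const_mul _
  · refine Eventually.of_forall fun x z _ => ?_
    have h1 : HasDerivAt (fun z : ℂ => z * (b x * Complex.I)) (b x * Complex.I) z := by
      simpa using (hasDerivAt_id z).mul_const ((b x : ℂ) * Complex.I)
    exact h1.cexp.mul_const (g x)

/-- A measurable set of positive measure is met in a set of positive length by some line through
any given point. -/
theorem exists_volume_line_inter_ne_zero {S : Set (EuclideanSpace ℝ (Fin n))}
    (hS : MeasurableSet S) (h0 : volume S ≠ 0) (ξ : EuclideanSpace ℝ (Fin n)) :
    ∃ x : EuclideanSpace ℝ (Fin n), volume {t : ℝ | t ∈ Set.Icc 1 2 ∧ ξ + t • x ∈ S} ≠ 0 := by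
  by_contra! hcon
  set E : Set (EuclideanSpace ℝ (Fin n) × ℝ) := {p | p.2 ∈ Set.Icc 1 2 ∧ ξ + p.2 • p.1 ∈ S} with hE
  have hEm : MeasurableSet E := by
    refine (measurableSet_Icc.preimage measurable_snd).inter (hS.preimage ?_)
    exact (continuous_const.add (continuous_snd.smul continuous_fst)).measurable
  have h1 : (volume.prod volume) E = 0 := by
    rw [Measure.measure_prod_null hEm]
    exact Eventually.of_forall fun x => hcon x
  have h2 : ∀ᵐ t : ℝ, volume {x : EuclideanSpace ℝ (Fin n) | (x, t) ∈ E} = 0 := by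
    have := Measure.measure_ae_null_of_prod_null (μ := volume) (ν := volume)
      (s := Prod.swap ⁻¹' E) (by
        rw [(Measure.measurePreserving_swap (μ := (volume : Measure ℝ))
          (ν := (volume : Measure (EuclideanSpace ℝ (Fin n))))).measure_preimage
          hEm.nullMeasurableSet]
        exact h1)
    exact this
  -- By Fubini almost every slice in x is null. Since t ∈ [1, 2] is nonzero, the slice is an
  -- invertible affine preimage of S, so S would be null.
  have h3 : ∃ t ∈ Set.Icc (1 : ℝ) 2, volume {x : EuclideanSpace ℝ (Fin n) | (x, t) ∈ E} = 0 := by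
    have h4 : (∃ᵐ t : ℝ, t ∈ Set.Icc (1 : ℝ) 2) := by
      intro h
      have : volume (Set.Icc (1 : ℝ) 2) = 0 := measure_eq_zero_iff_ae_notMem.2 h
      norm_num at this
    obtain ⟨t, ht, ht'⟩ := (h4.and_eventually h2).exists
    exact ⟨t, ht, ht'⟩
  obtain ⟨t, ht, h5⟩ := h3
  have ht0 : t ≠ 0 := by linarith [ht.1]
  have h6 : {x : EuclideanSpace ℝ (Fin n) | (x, t) ∈ E} =
      (t • ·) ⁻¹' ((ξ + ·) ⁻¹' S) := by
    ext x
    exact ⟨fun h => h.2, fun h => ⟨ht, h⟩⟩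
  rw [h6, Measure.addHaar_preimage_smul _ ht0, measure_preimage_add] at h5
  rcases mul_eq_zero.1 h5 with h7 | h7
  · rw [ENNReal.ofReal_eq_zero] at h7
    have : 0 < |(t ^ Module.finrank ℝ (EuclideanSpace ℝ (Fin n)))⁻¹| :=
      abs_pos.2 (inv_ne_zero (pow_ne_zero _ ht0))
    linarith
  · exact h0 h7

/-- The Fourier transform of an integrable function of bounded support is zero if it vanishes on a
set of positive measure. -/
theorem fourier_eq_zero_of_volume_ne_zero {g : EuclideanSpace ℝ (Fin n) → ℂ}
    (hg : Integrable g volume) {r : ℝ} (hr : ∀ x, g x ≠ 0 → ‖x‖ ≤ r)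
    (h0 : volume {ξ | 𝓕 g ξ = 0} ≠ 0) (ξ : EuclideanSpace ℝ (Fin n)) : 𝓕 g ξ = 0 := by
  have hcont : Continuous (𝓕 g) :=
    VectorFourier.fourierIntegral_continuous Real.continuous_fourierChar
      (by exact continuous_inner) hg
  -- On this line through ξ the transform extends to an entire function of t; its zeros accumulate
  -- in [1, 2], so it also vanishes at t = 0, the point ξ.
  obtain ⟨x, hx⟩ := exists_volume_line_inter_ne_zero
    (isClosed_eq hcont continuous_const).measurableSet h0 ξ
  set h : EuclideanSpace ℝ (Fin n) → ℂ := fun y => (Real.fourierChar (-inner ℝ y ξ)) • g y with hh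
  have hhi : Integrable h volume := by
    have := (VectorFourier.fourierIntegral_convergent_iff (μ := volume)
      (L := innerₗ (EuclideanSpace ℝ (Fin n))) Real.continuous_fourierChar
      (by exact continuous_inner) (f := g) ξ).2 hg
    exact this
  set b : EuclideanSpace ℝ (Fin n) → ℝ := fun y => -2 * Real.pi * inner ℝ y x with hb
  have hbm : Continuous b := by fun_prop
  have hdiff := differentiable_integral_exp_mul hhi hbm.aestronglyMeasurable
    (M := 2 * Real.pi * (r * ‖x‖)) fun y hy => by
      have hy' : g y ≠ 0 := fun h => hy (by simp only [hh, h, smul_zero])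
      have h1 : |inner ℝ y x| ≤ r * ‖x‖ :=
        (abs_real_inner_le_norm y x).trans (by gcongr; exact hr y hy')
      rw [hb, abs_mul, abs_mul, abs_neg, abs_two, abs_of_pos Real.pi_pos]
      gcongr
  have hval : ∀ t : ℝ, ∫ y, Complex.exp (t * (b y * Complex.I)) * h y = 𝓕 g (ξ + t • x) := by
    intro t
    rw [Real.fourier_eq]
    refine integral_congr_ae (Eventually.of_forall fun y => ?_)
    simp only [hh, hb, Circle.smul_def, Real.fourierChar_apply, smul_eq_mul]
    rw [← mul_assoc, ← Complex.exp_add]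
    congr 2
    rw [inner_add_right, inner_smul_right]
    push_cast
    ring
  have := eq_zero_of_volume_setOf_eq_zero_ne_zero hdiff hx (fun t ht => ht.1)
    (fun t ht => (hval t).trans ht.2) ((0 : ℝ) : ℂ)
  rw [hval 0, zero_smul, add_zero] at this
  exact this

end UniqueContinuation

/-! ### Consequences for the pair P_I, Q_J -/

section TimeFrequency
open scoped FourierTransform
variable {n : ℕ} {I J : Set (EuclideanSpace ℝ (Fin n))}

theorem fourier_eq_zero_of_projTime_eq (hI : NullMeasurableSet I volume)
    (hIb : Bornology.IsBounded I) {f : L2Rn n} (hf : projTime hI f = f)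
    (h0 : volume {ξ | 𝓕 (f : EuclideanSpace ℝ (Fin n) → ℂ) ξ = 0} ≠ 0) :
    𝓕 (f : EuclideanSpace ℝ (Fin n) → ℂ) = 0 := by
  have hfi : Integrable f volume := hf ▸ integrable_projTime hI hIb.measure_lt_top f
  have hae : f =ᵐ[volume] I.indicator f := by
    conv_lhs => rw [← hf]
    exact coeFn_projTime hI f
  have heq : 𝓕 (f : EuclideanSpace ℝ (Fin n) → ℂ) = 𝓕 (I.indicator f) :=
    funext (Real.fourier_congr_ae hae)
  rw [heq] at h0 ⊢
  obtain ⟨r, hr⟩ := hIb.exists_norm_le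
  exact funext (fourier_eq_zero_of_volume_ne_zero ((integrable_congr hae).1 hfi)
    (fun x hx => hr x (Set.mem_of_indicator_ne_zero hx)) h0)

theorem ae_eq_zero_of_projTime_eq_zero (hJ : NullMeasurableSet J volume) {f : L2Rn n}
    (hf : projTime hJ f = 0) : ∀ᵐ x ∂(volume : Measure (EuclideanSpace ℝ (Fin n))),
      x ∈ J → f x = 0 := by
  filter_upwards [coeFn_projTime hJ f, Lp.coeFn_zero ℂ 2 volume] with x h1 h2 hx
  rw [hf, h2, Set.indicator_of_mem hx] at h1
  exact h1.symm

theorem eq_zero_of_projTime_fourier_eq_zero (hI : NullMeasurableSet I volume)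
    (hJ : NullMeasurableSet J volume) (hIb : Bornology.IsBounded I) (hJ0 : volume J ≠ 0)
    {f : L2Rn n} (hf : projTime hI f = f)
    (h : projTime hJ (Lp.fourierTransformₗᵢ (EuclideanSpace ℝ (Fin n)) ℂ f) = 0) : f = 0 := by
  have hae := fourier_coeFn_ae_eq f (hf ▸ integrable_projTime hI hIb.measure_lt_top f)
  have hz : 𝓕 (f : EuclideanSpace ℝ (Fin n) → ℂ) = 0 := by
    refine fourier_eq_zero_of_projTime_eq hI hIb hf fun h0 => hJ0 (measure_mono_null_ae ?_ h0)
    filter_upwards [hae, ae_eq_zero_of_projTime_eq_zero hJ h] with x h1 h2 hx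
    exact h1.symm.trans (h2 hx)
  rw [hz] at hae
  have : Lp.fourierTransformₗᵢ (EuclideanSpace ℝ (Fin n)) ℂ f = 0 := (Lp.eq_zero_iff_ae_eq_zero).2 hae
  simpa using this

theorem eq_zero_of_projTime_fourier_symm_eq_zero (hI : NullMeasurableSet I volume)
    (hJ : NullMeasurableSet J volume) (hIb : Bornology.IsBounded I) (hJ0 : volume J ≠ 0)
    {f : L2Rn n} (hf : projTime hI f = f)
    (h : projTime hJ ((Lp.fourierTransformₗᵢ (EuclideanSpace ℝ (Fin n)) ℂ).symm f) = 0) :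
    f = 0 := by
  have hae := fourier_symm_coeFn_ae_eq f (hf ▸ integrable_projTime hI hIb.measure_lt_top f)
  have hz : 𝓕 (f : EuclideanSpace ℝ (Fin n) → ℂ) = 0 := by
    refine fourier_eq_zero_of_projTime_eq hI hIb hf fun h0 => hJ0 ?_
    -- The inverse transform is the transform reflected through the origin, and reflection preserves
    -- null sets.
    rw [← Measure.measure_preimage_neg volume] at h0
    refine measure_mono_null_ae ?_ h0
    filter_upwards [hae, ae_eq_zero_of_projTime_eq_zero hJ h] with x h1 h2 hx
    rw [Real.fourierInv_eq_fourier_neg] at h1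
    exact h1.symm.trans (h2 hx)
  have hz' : 𝓕⁻ (f : EuclideanSpace ℝ (Fin n) → ℂ) = 0 := by
    ext x
    rw [Real.fourierInv_eq_fourier_neg, hz]
    rfl
  rw [hz'] at hae
  have : (Lp.fourierTransformₗᵢ (EuclideanSpace ℝ (Fin n)) ℂ).symm f = 0 :=
    (Lp.eq_zero_iff_ae_eq_zero).2 hae
  simpa using this

theorem projFreq_apply (hJ : NullMeasurableSet J volume) (f : L2Rn n) :
    projFreq hJ f = (Lp.fourierTransformₗᵢ (EuclideanSpace ℝ (Fin n)) ℂ).symm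
      (projTime hJ (Lp.fourierTransformₗᵢ (EuclideanSpace ℝ (Fin n)) ℂ f)) := rfl

theorem eq_zero_of_projTime_eq_of_projFreq_eq_zero (hI : NullMeasurableSet I volume)
    (hJ : NullMeasurableSet J volume) (hIb : Bornology.IsBounded I) (hJ0 : volume J ≠ 0)
    {f : L2Rn n} (hf : projTime hI f = f) (h : projFreq hJ f = 0) : f = 0 := by
  rw [projFreq_apply, LinearIsometryEquiv.map_eq_zero_iff] at h
  exact eq_zero_of_projTime_fourier_eq_zero hI hJ hIb hJ0 hf h

theorem rangesMeetKernelsTrivially_of_isBounded (hI : NullMeasurableSet I volume)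
    (hJ : NullMeasurableSet J volume) (hI0 : volume I ≠ 0) (hJ0 : volume J ≠ 0)
    (hIb : Bornology.IsBounded I) (hJb : Bornology.IsBounded J) :
    RangesMeetKernelsTrivially (projTime hI) (projFreq hJ) := by
  have hP := isStarProjection_projTime hI
  have hQ := isStarProjection_projFreq hJ
  constructor
  · rw [Submodule.eq_bot_iff]
    rintro _ ⟨⟨f, rfl⟩, hk⟩
    exact eq_zero_of_projTime_eq_of_projFreq_eq_zero hI hJ hIb hJ0 (hP.apply_apply f) hk
  · rw [Submodule.eq_bot_iff]
    rintro f ⟨hk, g, hg⟩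
    have hQf : projFreq hJ f = f := by
      rw [← hg]
      exact hQ.apply_apply g
    have hPf : projTime hI f = 0 := hk
    set F := Lp.fourierTransformₗᵢ (EuclideanSpace ℝ (Fin n)) ℂ
    have h1 : projTime hJ (F f) = F f := by
      rw [projFreq_apply] at hQf
      exact F.symm_apply_eq.1 hQf
    have h2 := eq_zero_of_projTime_fourier_symm_eq_zero hJ hI hJb hI0 h1
      (by rw [LinearIsometryEquiv.symm_apply_apply]; exact hPf)
    simpa using h2

/-- A measure without atoms, concentrated on its support, cannot be nonzero with finite support.
Lebesgue measure has no atoms because n > 0. -/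
theorem infinite_support_restrict (hn : 0 < n) (h0 : volume I ≠ 0) :
    (Measure.support ((volume : Measure (EuclideanSpace ℝ (Fin n))).restrict I)).Infinite := by
  have : Nonempty (Fin n) := ⟨⟨0, hn⟩⟩
  intro hfin
  have h1 : (volume : Measure (EuclideanSpace ℝ (Fin n))).restrict I
      (Measure.support ((volume : Measure (EuclideanSpace ℝ (Fin n))).restrict I)) = 0 :=
    hfin.measure_zero _
  have h2 := Measure.measure_compl_support
    (μ := (volume : Measure (EuclideanSpace ℝ (Fin n))).restrict I)
  have h3 := measure_union_null h1 h2
  rw [Set.union_compl_self, Measure.restrict_apply_univ] at h3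
  exact h0 h3

/-- Disjoint neighborhoods of d + 1 support points, d the supposed dimension, each meet I in
positive measure; their indicators cut to I are orthogonal and nonzero. -/
theorem not_finiteDimensional_range_projTime (hn : 0 < n) (hI : NullMeasurableSet I volume)
    (h0 : volume I ≠ 0) : ¬ FiniteDimensional ℂ (projTime hI).range := by
  intro hfd
  have hinf := infinite_support_restrict hn h0
  obtain ⟨T, hT, hcard⟩ := hinf.exists_subset_card_eq
    (Module.finrank ℂ (projTime hI).range + 1)
  obtain ⟨U, hU, hdisj⟩ := T.finite_toSet.t2_separation
  let W : EuclideanSpace ℝ (Fin n) → Set (EuclideanSpace ℝ (Fin n)) :=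
    fun p => U p ∩ Metric.ball p 1
  have hWo : ∀ p, IsOpen (W p) := fun p => (hU p).2.inter Metric.isOpen_ball
  have hWm : ∀ p, MeasurableSet (W p) := fun p => (hWo p).measurableSet
  have hWf : ∀ p, volume (W p) ≠ ∞ := fun p =>
    ((measure_mono Set.inter_subset_right).trans_lt measure_ball_lt_top).ne
  have hWI : ∀ p ∈ T, volume (W p ∩ I) ≠ 0 := by
    intro p hp
    have h1 := (Measure.mem_support_iff_forall p).1 (hT hp) (W p)
      ((hWo p).mem_nhds ⟨(hU p).1, Metric.mem_ball_self one_pos⟩)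
    rw [Measure.restrict_apply (hWm p)] at h1
    exact h1.ne'
  let g : EuclideanSpace ℝ (Fin n) → L2Rn n := fun p =>
    projTime hI (projTime (hWm p).nullMeasurableSet (indicatorConstLp 2 (hWm p) (hWf p) (1 : ℂ)))
  have hg0 : ∀ p ∈ T, g p ≠ 0 := by
    intro p hp hgp
    refine hWI p hp (measure_eq_zero_iff_ae_notMem.2 ?_)
    filter_upwards [ae_eq_zero_of_projTime_eq_zero hI hgp,
      coeFn_projTime (hWm p).nullMeasurableSet (indicatorConstLp 2 (hWm p) (hWf p) (1 : ℂ)),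
      indicatorConstLp_coeFn (p := 2) (hs := hWm p) (hμs := hWf p) (c := (1 : ℂ))] with x h1 h2 h3 hx
    have h4 := h1 hx.2
    rw [h2, Set.indicator_of_mem hx.1, h3, Set.indicator_of_mem hx.1] at h4
    exact one_ne_zero h4
  have horth : ∀ p ∈ T, ∀ q ∈ T, p ≠ q → inner ℂ (g p) (g q) = 0 := by
    intro p hp q hq hpq
    have hz : volume (W p ∩ (I ∩ W q)) = 0 := by
      have : W p ∩ (I ∩ W q) = ∅ := by
        have h1 := Set.disjoint_left.1 (hdisj hp hq hpq)
        ext x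
        simp only [Set.mem_inter_iff, Set.mem_empty_iff_false, iff_false]
        rintro ⟨hx1, -, hx2⟩
        exact h1 hx1.1 hx2.1
      rw [this, measure_empty]
    have hzero : projTime (hWm p).nullMeasurableSet *
        (projTime hI * projTime (hWm q).nullMeasurableSet) = 0 := by
      rw [projTime_mul_projTime, projTime_mul_projTime, projTime_eq_zero _ hz]
    change inner ℂ (projTime hI (projTime _ _)) (projTime hI (projTime _ _)) = 0
    rw [(isStarProjection_projTime hI).inner_left, (isStarProjection_projTime hI).apply_apply,
      (isStarProjection_projTime _).inner_left]
    have h2 := congrArg (fun A : L2Rn n →L[ℂ] L2Rn n => inner ℂ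
      (indicatorConstLp 2 (hWm p) (hWf p) (1 : ℂ))
      (A (indicatorConstLp 2 (hWm q) (hWf q) (1 : ℂ)))) hzero
    refine h2.trans ?_
    exact inner_zero_right _
  have hli : LinearIndependent ℂ (fun p : T => g p) :=
    linearIndependent_of_ne_zero_of_inner_eq_zero (fun p => hg0 p p.2)
      fun p q hpq => horth p p.2 q q.2 fun h => hpq (Subtype.ext h)
  have hli' : LinearIndependent ℂ (fun p : T => (⟨g p, ⟨_, rfl⟩⟩ : (projTime hI).range)) :=
    LinearIndependent.of_comp (projTime hI).range.subtype hli
  have := hli'.fintype_card_le_finrank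
  rw [Fintype.card_coe, hcard] at this
  omega

/-- I may be unbounded, so it is cut down to a ball. On the infinite dimensional L²(I ∩ ball), PQP
is injective: ⟨f, PQPf⟩ = ‖Qf‖², and Qf = 0 forces f = 0 by unique continuation. -/
theorem not_finiteDimensional_range_corner (hn : 0 < n) (hI : NullMeasurableSet I volume)
    (hJ : NullMeasurableSet J volume) (hI0 : volume I ≠ 0) (hJ0 : volume J ≠ 0) :
    ¬ FiniteDimensional ℂ (projTime hI * projFreq hJ * projTime hI).range := by
  intro hfd
  obtain ⟨k, hk⟩ : ∃ k : ℕ, volume (I ∩ Metric.ball 0 k) ≠ 0 := by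
    by_contra! hcon
    apply hI0
    have : I = ⋃ k : ℕ, I ∩ Metric.ball 0 k := by
      rw [← Set.inter_iUnion, Metric.iUnion_ball_nat, Set.inter_univ]
    rw [this]
    exact measure_iUnion_null hcon
  have hb : NullMeasurableSet (Metric.ball (0 : EuclideanSpace ℝ (Fin n)) k) volume :=
    measurableSet_ball.nullMeasurableSet
  set hI' := hI.inter hb
  have hP := isStarProjection_projTime hI
  have hQ := isStarProjection_projFreq hJ
  have hP' := isStarProjection_projTime hI'
  have hsub : ∀ f, projTime hI (projTime hI' f) = projTime hI' f := by
    intro f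
    have : projTime hI * projTime hI' = projTime hI' := by
      rw [← projTime_mul_projTime hI hb, ← mul_assoc, hP.isIdempotentElem.eq]
    exact congrArg (· f) this
  refine not_finiteDimensional_range_projTime hn hI' hk ?_
  let T : (projTime hI').range →ₗ[ℂ] (projTime hI * projFreq hJ * projTime hI).range :=
    ((projTime hI * projFreq hJ * projTime hI : L2Rn n →L[ℂ] L2Rn n) :
      L2Rn n →ₗ[ℂ] L2Rn n).rangeRestrict ∘ₗ (projTime hI').range.subtype
  refine FiniteDimensional.of_injective T ((injective_iff_map_eq_zero T).2 ?_)
  rintro ⟨_, f, rfl⟩ hf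
  have h1 : (projTime hI * projFreq hJ * projTime hI) (projTime hI' f) = 0 := congrArg Subtype.val hf
  have h2 := hP.inner_corner hQ (projTime hI' f)
  rw [h1, inner_zero_right, hsub] at h2
  have h3 : projFreq hJ (projTime hI' f) = 0 := by
    have : ‖projFreq hJ (projTime hI' f)‖ ^ 2 = 0 := by exact_mod_cast h2.symm
    simpa using this
  exact Subtype.ext (eq_zero_of_projTime_eq_of_projFreq_eq_zero hI' hJ
    (Metric.isBounded_ball.subset Set.inter_subset_right) hJ0 (hP'.apply_apply f) h3)

theorem exists_disjoint_volume_pos (hn : 0 < n) (hI : NullMeasurableSet I volume)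
    (hI1 : volume I < ∞) : ∃ I₀ : Set (EuclideanSpace ℝ (Fin n)), NullMeasurableSet I₀ volume ∧
      volume I₀ ≠ 0 ∧ volume I₀ < ∞ ∧ Disjoint I I₀ := by
  have : Nonempty (Fin n) := ⟨⟨0, hn⟩⟩
  obtain ⟨k, hk⟩ : ∃ k : ℕ, volume (Metric.ball (0 : EuclideanSpace ℝ (Fin n)) k \ I) ≠ 0 := by
    by_contra! hcon
    have h1 : volume (Iᶜ) = 0 := by
      have : Iᶜ = ⋃ k : ℕ, Metric.ball 0 (k : ℝ) \ I := by
        rw [← Set.iUnion_sdiff, Metric.iUnion_ball_nat, Set.compl_eq_univ_sdiff]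
      rw [this]
      exact measure_iUnion_null hcon
    have h2 : volume (Set.univ : Set (EuclideanSpace ℝ (Fin n))) ≤ volume I + volume Iᶜ := by
      rw [← Set.union_compl_self I]
      exact measure_union_le _ _
    rw [h1, add_zero, measure_univ_of_isAddLeftInvariant] at h2
    exact absurd h2 (not_le.2 hI1)
  exact ⟨_, measurableSet_ball.nullMeasurableSet.diff hI, hk,
    (measure_mono Set.sdiff_subset).trans_lt measure_ball_lt_top, Set.disjoint_sdiff_right⟩

end TimeFrequency

theorem mainTheorem5 (n : ℕ) (hn : 0 < n) (I J : Set (EuclideanSpace ℝ (Fin n)))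
    (hI : NullMeasurableSet I volume) (hJ : NullMeasurableSet J volume)
    (hI0 : 0 < volume I) (hI1 : volume I < ∞) (hJ0 : 0 < volume J) (hJ1 : volume J < ∞) :
    -- existence and uniqueness of the operator
    (Bornology.IsBounded I → Bornology.IsBounded J →
      RangesMeetKernelsTrivially (projTime hI) (projFreq hJ)) ∧
    (RangesMeetKernelsTrivially (projTime hI) (projFreq hJ) →
      ∃! X : L2Rn n →L[ℂ] L2Rn n, IsGeodesicExponent (projTime hI) (projFreq hJ) X) ∧
    ∀ X : L2Rn n →L[ℂ] L2Rn n, IsGeodesicExponent (projTime hI) (projFreq hJ) X →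
      -- closed infinite dimensional range, not compact
      (IsClosed (X.range : Set (L2Rn n)) ∧ ¬ FiniteDimensional ℂ X.range ∧
        ¬ IsCompactOperator X) ∧
      -- the spectrum
      (∃ γ : ℕ → ℝ, StrictMono γ ∧ (∀ k, 0 < γ k ∧ γ k < Real.pi / 2) ∧
        Tendsto γ atTop (𝓝 (Real.pi / 2)) ∧
        spectrum ℂ X = {0} ∪ Set.range (fun k => (γ k : ℂ)) ∪ Set.range (fun k => -(γ k : ℂ)) ∪
          {((Real.pi / 2 : ℝ) : ℂ), -((Real.pi / 2 : ℝ) : ℂ)} ∧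
        ¬ FiniteDimensional ℂ (eigSpace X 0) ∧
        (∀ k, eigSpace X (γ k) ≠ ⊥ ∧ FiniteDimensional ℂ (eigSpace X (γ k)) ∧
          FiniteDimensional ℂ (eigSpace X (-(γ k))) ∧
          Module.finrank ℂ (eigSpace X (γ k)) = Module.finrank ℂ (eigSpace X (-(γ k)))) ∧
        (RangesMeetKernelsTrivially (projTime hI) (projFreq hJ) →
          eigSpace X ((Real.pi / 2 : ℝ) : ℂ) = ⊥ ∧ eigSpace X (-((Real.pi / 2 : ℝ) : ℂ)) = ⊥)) ∧
      -- compact commutators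
      (∀ (I₀ : Set (EuclideanSpace ℝ (Fin n))) (hI₀ : NullMeasurableSet I₀ volume),
        volume I₀ < ∞ → volume (I ∩ I₀) = 0 →
          IsCompactOperator (X * projTime hI₀ - projTime hI₀ * X)) := by
  have hP := isStarProjection_projTime hI
  have hQ := isStarProjection_projFreq hJ
  have hK : IsCompactOperator (projTime hI * projFreq hJ * projTime hI) := by
    rw [mul_assoc]
    exact (isCompactOperator_projFreq_mul_projTime hI hJ hI1 hJ1).1.clm_mul _
  have hKr := not_finiteDimensional_range_corner hn hI hJ hI0.ne' hJ0.ne'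
  have hPr := not_finiteDimensional_range_projTime hn hI hI0.ne'
  have hmul : ∀ {I₀ : Set (EuclideanSpace ℝ (Fin n))} (hI₀ : NullMeasurableSet I₀ volume),
      volume (I ∩ I₀) = 0 →
        projTime hI * projTime hI₀ = 0 ∧ projTime hI₀ * projTime hI = 0 := by
    intro I₀ hI₀ h0
    rw [projTime_mul_projTime, projTime_mul_projTime, projTime_eq_zero _ h0,
      projTime_eq_zero _ (by rwa [Set.inter_comm])]
    exact ⟨rfl, rfl⟩
  refine ⟨rangesMeetKernelsTrivially_of_isBounded hI hJ hI0.ne' hJ0.ne', fun hR => ?_,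
    fun X hX => ?_⟩
  · obtain ⟨X, hX⟩ := exists_isGeodesicExponent hP hQ hR hK hPr
    exact ⟨X, hX, fun Y hY => hY.unique hP hQ hR hX⟩
  -- An auxiliary set off I, of positive finite measure; its projection has infinite rank and
  -- witnesses the infinite dimensional kernel.
  · obtain ⟨I₀, hI₀, h0, h1, hdisj⟩ := exists_disjoint_volume_pos hn hI hI1
    obtain ⟨m1, m2⟩ := hmul hI₀ (by rw [hdisj.inter_eq, measure_empty])
    have hker := hX.not_finiteDimensional_eigSpace_zero hP hQ hK (isStarProjection_projTime hI₀)
      (not_finiteDimensional_range_projTime hn hI₀ h0) m1 m2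
      (isCompactOperator_projFreq_mul_projTime hI₀ hJ h1 hJ1).1
    obtain ⟨γ, hmono, hγ, hlim, hspec, hne⟩ := hX.exists_spectrum_eq hP hQ hK hKr
      (fun h => hker (by rw [h]; infer_instance))
    have hXr := IsGeodesicExponent.not_finiteDimensional_range hmono.injective
      (fun k => (hγ k).1.ne') hne
    refine ⟨⟨hX.isClosed_range hP hQ hK, hXr, hX.not_isCompactOperator hP hQ hK hXr⟩,
      ⟨γ, hmono, hγ, hlim, hspec, hker, fun k => ?_, fun hR => ?_⟩, fun I₁ hI₁ hfin hdis => ?_⟩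
    · have hfd := hX.finiteDimensional_eigSpace hP hQ hK (hγ k).1 (hγ k).2
      have e := hX.eigSpaceEquivNeg hP (γ k)
      exact ⟨hne k, hfd, e.finiteDimensional, e.finrank_eq⟩
    · have hbot := hX.eigSpace_eq_bot_of_cos_eq_zero hP hQ hR Real.cos_pi_div_two
      exact ⟨hbot, (hX.eigSpace_neg_eq_bot_iff hP _).2 hbot⟩
    · obtain ⟨m1, m2⟩ := hmul hI₁ hdis
      obtain ⟨c1, c2⟩ := isCompactOperator_projFreq_mul_projTime hI₁ hJ hfin hJ1
      exact hX.isCompactOperator_commutator hP m1 m2 c1 c2
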